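/- Let $k_1>0$, $k_2<0$ with $k_c:=k_1+4k_2>0$. For functions on lattice points put $(\Delta_1u)_i=u_{i-1}-2u_i+u_{i+1}$, $(\Delta_2u)_i=u_{i-2}-2u_i+u_{i+2}$, $A=-k_1\Delta_1-k_2\Delta_2$, $C=-k_c\Delta_1$; for a finite set $\sigma\subset\mathbb Z$ let $(u,v)_{\ell^2(\sigma)}=\sum_{i\in\sigma}u_iv_i$ and $\|u\|_{\ell^2(\sigma)}=(u,u)_{\ell^2(\sigma)}^{1/2}$. Given integers $0<K<L<N$, let $\Omega=[0,N]\cap\mathbb Z$, $\Omega_a=[0,L]\cap\mathbb Z$, $\Omega_c=[K,N-1]\cap\mathbb Z$, $\Omega_o=\Omega_a\cap\Omega_c=[K,L]\cap\mathbb Z$, and let $\mathcal U_0$ be the space of $u:\Omega\to\mathbb R$ with $u_0=u_1=u_{N-1}=u_N=0$. For $u\in\mathcal U_0$ let $(\Delta_1^2u)_i=u_{i-2}-4u_{i-1}+6u_i-4u_{i+1}+u_{i+2}$ for $2\le i\le N-2$ and $(\Delta_1^2u)_i=0$ for $i\in\{0,1,N-1,N\}$. Given $f\in\mathcal U_0$: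 * $\tilde u^a\in\mathcal U_0$ is a solution of $(A\tilde u^a)_i=f_i$ for $2\le i\le N-2$. * For $\theta^a=(\theta^a_{L-1},\theta^a_L)\in\Lambda_a:=\mathbb R^2$, $v^a(\theta^a):\Omega_a\to\mathbb R$ is the solution of $Av^a=0$ on $[2,L-2]\cap\mathbb Z$, $v^a_0=v^a_1=0$, $v^a_{L-1}=\theta^a_{L-1}$, $v^a_L=\theta^a_L$; and $u^{a,0}:\Omega_a\to\mathbb R$ is the solution of $Au^{a,0}=f$ on $[2,L-2]\cap\mathbb Z$ that vanishes at $0,1,L-1,L$. * For $\theta^c\in\Lambda_c:=\mathbb R$, $v^c(\theta^c):\Omega_c\to\mathbb R$ is the solution of $Cv^c=0$ on $[K+1,N-2]\cap\mathbb Z$, $v^c_K=\theta^c$, $v^c_{N-1}=0$; and $u^{c,0}:\Omega_c\to\mathbb R$ is the solution of $Cu^{c,0}=f$ on $[K+1,N-2]\cap\mathbb Z$ that vanishes at $K,N-1$. * $\{\theta^a_{op},\theta^c_{op}\}$ is a minimizer over $\Lambda_a\times\Lambda_c$ of $$\tfrac12\|v^a(\theta^a)-v^c(\theta^c)\|^2_{\ell^2(\Omega_o)}+\big(v^a(\theta^a)-v^c(\theta^c),\,u^{a,0}-u^{c,0}\big)_{\ell^2(\Omega_o)}+\tfrac12\|u^{a,0}-u^{c,0}\|^2_{\ell^2(\Omega_o)}.$$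 * $u^{atc}:\Omega\to\mathbb R$ equals $u^{a,0}+v^a(\theta^a_{op})$ on $\Omega_a$, equals $u^{c,0}+v^c(\theta^c_{op})$ on $\Omega_c\setminus\Omega_o$, and is $0$ at $N$. **Theorem.** Let $p>1$ and $M>0$. There is a constant $c>0$, depending only on $k_1,k_2,p,M$, such that for all integers $0<K<L<N$ with $L\le M N^{1/p}$, for $\gamma:=(L-K)/L$, provided that $3/L<\gamma<1$, and for all $f\in\mathcal U_0$, every $\tilde u^a$ and every minimizer $\{\theta^a_{op},\theta^c_{op}\}$ as above, $$\|\tilde u^a-u^{atc}\|_{\ell^2(\Omega)}\le c\left(1+\gamma^{-1}\sqrt{\frac{N}{L-K}}\right)(N-K)^2\,\|\Delta_1^2\tilde u^a\|_{\ell^2(\Omega_c)}.$$ -/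

import Mathlib

/-!
Lattice displacements are encoded as functions `ℤ → ℝ` that are only ever read on the relevant
finite set of atoms `Finset.Icc a b` (which is `[a, b] ∩ ℤ`); displacements living on a subdomain
are extended by zero outside of it.
-/

noncomputable section

namespace AtC

/-- The inner product of `ℓ²(σ)` for a finite set of atoms `σ`. -/
def l2inner (σ : Finset ℤ) (u v : ℤ → ℝ) : ℝ := ∑ i ∈ σ, u i * v i

/-- The norm of `ℓ²(σ)` for a finite set of atoms `σ`. -/
def l2norm (σ : Finset ℤ) (u : ℤ → ℝ) : ℝ := Real.sqrt (l2inner σ u u)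

/-- The first neighbour difference `(Δ₁ u)_i = u_{i-1} - 2 u_i + u_{i+1}`. -/
def lap1 (u : ℤ → ℝ) (i : ℤ) : ℝ := u (i - 1) - 2 * u i + u (i + 1)

/-- The second neighbour difference `(Δ₂ u)_i = u_{i-2} - 2 u_i + u_{i+2}`. -/
def lap2 (u : ℤ → ℝ) (i : ℤ) : ℝ := u (i - 2) - 2 * u i + u (i + 2)

/-- `Δ₁² u` on the chain `[0, N]`: at the interior atoms `2, …, N - 2` it is
`u_{i-2} - 4 u_{i-1} + 6 u_i - 4 u_{i+1} + u_{i+2}`, so that `Δ₂ - 4 Δ₁ = Δ₁²` there, and it vanishes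
at the fixed boundary atoms `0, 1, N - 1, N`, as do all elements of the space `𝒰₀`. -/
def lap1Sq (N : ℤ) (u : ℤ → ℝ) (i : ℤ) : ℝ :=
  if i ∈ Finset.Icc 2 (N - 2) then lap1 (lap1 u) i else 0

/-- The atomistic operator `A = -k₁ Δ₁ - k₂ Δ₂`. -/
def atomOp (k₁ k₂ : ℝ) (u : ℤ → ℝ) (i : ℤ) : ℝ := -(k₁ * lap1 u i + k₂ * lap2 u i)

/-- The continuum operator `C = -k_c Δ₁`, with `k_c = k₁ + 4 k₂`. -/
def contOp (k₁ k₂ : ℝ) (u : ℤ → ℝ) (i : ℤ) : ℝ := -((k₁ + 4 * k₂) * lap1 u i)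

/-- Membership in `𝒰₀`: `u` vanishes on `Γ⁻ ∪ Γ⁺ = {0, 1} ∪ {N - 1, N}`. -/
def MemU0 (N : ℤ) (u : ℤ → ℝ) : Prop := u 0 = 0 ∧ u 1 = 0 ∧ u (N - 1) = 0 ∧ u N = 0

/-- `u ∈ 𝒰₀` solves the fully atomistic problem `A u = f` at the atoms `2, …, N - 2`. -/
def IsAtomisticSolution (k₁ k₂ : ℝ) (N : ℤ) (f u : ℤ → ℝ) : Prop :=
  MemU0 N u ∧ ∀ i ∈ Finset.Icc 2 (N - 2), atomOp k₁ k₂ u i = f i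

/-- The atomistic subproblem on `Ω_a = [0, L]`: `A u = g` at the atoms `2, …, L - 2`,
`u = 0` on `Γ_a⁻ = {0, 1}` and `u = θ` on `Γ_a⁺ = {L - 1, L}`; the trace `θ ∈ Λ_a` is the pair
`(θ_{L-1}, θ_L)`. Outside `Ω_a` the displacement is extended by zero. -/
structure IsAtomSub (k₁ k₂ : ℝ) (L : ℤ) (g : ℤ → ℝ) (θ : ℝ × ℝ) (u : ℤ → ℝ) : Prop where
  eq : ∀ i ∈ Finset.Icc 2 (L - 2), atomOp k₁ k₂ u i = g i
  left0 : u 0 = 0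
  left1 : u 1 = 0
  right1 : u (L - 1) = θ.1
  right0 : u L = θ.2
  outside : ∀ i, i ∉ Finset.Icc 0 L → u i = 0

/-- The continuum subproblem on `Ω_c = [K, N - 1]`: `C u = g` at the atoms `K + 1, …, N - 2`,
`u = θ` on `Γ_c⁻ = {K}` and `u = 0` on `Γ_c⁺ = {N - 1}`. Outside `Ω_c` the displacement is
extended by zero. -/
structure IsContSub (k₁ k₂ : ℝ) (K N : ℤ) (g : ℤ → ℝ) (θ : ℝ) (u : ℤ → ℝ) : Prop where
  eq : ∀ i ∈ Finset.Icc (K + 1) (N - 2), contOp k₁ k₂ u i = g i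
  left : u K = θ
  right : u (N - 1) = 0
  outside : ∀ i, i ∉ Finset.Icc K (N - 1) → u i = 0

/-- The solution of the atomistic subproblem (see `atomSub_iff` for well-posedness). -/
def atomSub (k₁ k₂ : ℝ) (L : ℤ) (g : ℤ → ℝ) (θ : ℝ × ℝ) : ℤ → ℝ :=
  Classical.epsilon (IsAtomSub k₁ k₂ L g θ)

/-- The solution of the continuum subproblem (see `contSub_iff` for well-posedness). -/
def contSub (k₁ k₂ : ℝ) (K N : ℤ) (g : ℤ → ℝ) (θ : ℝ) : ℤ → ℝ :=
  Classical.epsilon (IsContSub k₁ k₂ K N g θ)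

/-- `v^a(θ^a)`: zero force, boundary values `θ^a`. -/
def va (k₁ k₂ : ℝ) (L : ℤ) (θ : ℝ × ℝ) : ℤ → ℝ := atomSub k₁ k₂ L 0 θ

/-- `v^c(θ^c)`: zero force, boundary value `θ^c`. -/
def vc (k₁ k₂ : ℝ) (K N : ℤ) (θ : ℝ) : ℤ → ℝ := contSub k₁ k₂ K N 0 θ

/-- `u^{a,0}`: force `f`, homogeneous boundary values. -/
def ua0 (k₁ k₂ : ℝ) (L : ℤ) (f : ℤ → ℝ) : ℤ → ℝ := atomSub k₁ k₂ L f 0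

/-- `u^{c,0}`: force `f`, homogeneous boundary values. -/
def uc0 (k₁ k₂ : ℝ) (K N : ℤ) (f : ℤ → ℝ) : ℤ → ℝ := contSub k₁ k₂ K N f 0

/-- The reduced objective on `Λ_a × Λ_c`, with `Ω_o = [K, L]`:
`½ ‖v^a(θ^a) - v^c(θ^c)‖² + (v^a(θ^a) - v^c(θ^c), u^{a,0} - u^{c,0}) + ½ ‖u^{a,0} - u^{c,0}‖²`. -/
def reducedObjective (k₁ k₂ : ℝ) (K L N : ℤ) (f : ℤ → ℝ) (θ : (ℝ × ℝ) × ℝ) : ℝ :=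
  1 / 2 * l2norm (Finset.Icc K L) (va k₁ k₂ L θ.1 - vc k₁ k₂ K N θ.2) ^ 2
    + l2inner (Finset.Icc K L) (va k₁ k₂ L θ.1 - vc k₁ k₂ K N θ.2)
        (ua0 k₁ k₂ L f - uc0 k₁ k₂ K N f)
    + 1 / 2 * l2norm (Finset.Icc K L) (ua0 k₁ k₂ L f - uc0 k₁ k₂ K N f) ^ 2

/-- The affine map `P : Λ_a × Λ_c → 𝒰₀`: `u^{a,0} + v^a` on `Ω_a = [0, L]`, `u^{c,0} + v^c` on
`Ω_c \ Ω_o = [L + 1, N - 1]`, and zero at the fixed atom `N`. -/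
def atcMap (k₁ k₂ : ℝ) (K L N : ℤ) (f : ℤ → ℝ) (θ : (ℝ × ℝ) × ℝ) (i : ℤ) : ℝ :=
  if i ∈ Finset.Icc 0 L then ua0 k₁ k₂ L f i + va k₁ k₂ L θ.1 i
  else if i ∈ Finset.Icc (L + 1) (N - 1) then uc0 k₁ k₂ K N f i + vc k₁ k₂ K N θ.2 i
  else 0

/-! ### Well-posedness of the two subproblems -/

theorem eq_zero_of_atomOp (k₁ k₂ : ℝ) (hk₂ : k₂ ≤ 0) (hk : 0 < k₁ + 4 * k₂) (S : Finset ℤ)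
    (u : ℤ → ℝ) (hu : ∀ i, i ∉ S → u i = 0) (h : ∀ i ∈ S, atomOp k₁ k₂ u i = 0) : u = 0 := by
  have hfin : (Function.support u).Finite :=
    S.finite_toSet.subset fun i hi => by
      by_contra hc
      exact hi (hu i hc)
  have cv : ∀ {F G : ℤ → ℝ} {x y : ℝ}, HasSum F x → (∀ i, G i = F i) → y = x → HasSum G y :=
    fun {F G x y} hF hG hx => by rwa [hx, funext hG]
  have sm : ∀ a b : ℤ, Summable fun i => u (i + a) * u (i + b) := fun a b => by
    have : (Function.support fun i => u (i + a)).Finite :=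
      (hfin.preimage (add_left_injective a).injOn)
    exact summable_of_hasFiniteSupport (this.subset fun i hi => left_ne_zero_of_mul hi)
  have sh : ∀ a b c : ℤ, ∑' i, u (i + a) * u (i + b) = ∑' i, u (i + (a + c)) * u (i + (b + c)) := by
    intro a b c
    rw [← (Equiv.addRight c).tsum_eq]
    refine tsum_congr fun i => ?_
    simp only [Equiv.coe_addRight]
    congr 2 <;> ring
  set s : ℤ → ℝ := fun a => ∑' i, u (i + 0) * u (i + a) with hs
  have hS : ∀ a, HasSum (fun i => u (i + 0) * u (i + a)) (s a) := fun a => (sm 0 a).hasSum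
  have hG : ∀ a b, HasSum (fun i => u (i + a) * u (i + b)) (s (b - a)) := fun a b => by
    have := (sm a b).hasSum
    rw [sh a b (-a)] at this
    simpa [hs, sub_eq_add_neg] using this
  have e1 : s (-1) = s 1 := by
    have := sh 0 (-1) 1
    simp only [hs]
    rw [this]
    refine tsum_congr fun i => ?_
    norm_num [mul_comm]
  have e2 : s (-2) = s 2 := by
    have := sh 0 (-2) 2
    simp only [hs]
    rw [this]
    refine tsum_congr fun i => ?_
    norm_num [mul_comm]
  have E : HasSum (fun i => u i * atomOp k₁ k₂ u i) (2 * k₁ * (s 0 - s 1) + 2 * k₂ * (s 0 - s 2)) := by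
    have := (((hS 0).mul_left (2 * k₁ + 2 * k₂)).sub (((hS (-1)).add (hS 1)).mul_left k₁)).sub
      (((hS (-2)).add (hS 2)).mul_left k₂)
    refine cv this (fun i => ?_) ?_
    · simp only [atomOp, lap1, lap2, sub_eq_add_neg, add_zero]
      ring
    · rw [e1, e2]
      ring
  have E0 : 2 * k₁ * (s 0 - s 1) + 2 * k₂ * (s 0 - s 2) = 0 := by
    refine E.unique ?_
    refine cv hasSum_zero (fun i => ?_) rfl
    by_cases hi : i ∈ S
    · rw [h i hi, mul_zero]
    · rw [hu i hi, zero_mul]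
  have D : HasSum (fun i => (u (i + 1) - u i) ^ 2) (2 * (s 0 - s 1)) := by
    have := ((hG 1 1).add (hG 0 0)).sub ((hG 0 1).mul_left 2)
    refine cv this (fun i => ?_) ?_
    · simp only [add_zero]
      ring
    · norm_num
      ring
  have R : HasSum (fun i => (u (i + 2) - 2 * u (i + 1) + u i) ^ 2)
      (6 * s 0 - 8 * s 1 + 2 * s 2) := by
    have := ((((hG 2 2).add (hG 0 0)).add ((hG 1 1).mul_left 4)).sub
      (((hG 1 2).add (hG 0 1)).mul_left 4)).add ((hG 0 2).mul_left 2)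
    refine cv this (fun i => ?_) ?_
    · simp only [add_zero]
      ring
    · norm_num
      ring
  have hR : 0 ≤ 6 * s 0 - 8 * s 1 + 2 * s 2 := R.nonneg fun i => sq_nonneg _
  have hD : 0 ≤ 2 * (s 0 - s 1) := D.nonneg fun i => sq_nonneg _
  have hD0 : 2 * (s 0 - s 1) = 0 := by
    nlinarith [mul_nonneg (neg_nonneg.mpr hk₂) hR]
  rw [hD0, hasSum_zero_iff_of_nonneg fun i => sq_nonneg _] at D
  have step : ∀ i, u (i + 1) = u i := fun i => by
    have := congrFun D i
    simp only [Pi.zero_apply, sq_eq_zero_iff] at this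
    linarith
  obtain ⟨j, hj⟩ := S.exists_notMem
  have hall : ∀ i, u i = u 0 := fun i => by
    induction i using Int.induction_on with
    | zero => rfl
    | succ n ih => rw [step, ih]
    | pred n ih =>
      rw [← ih, ← step]
      ring_nf
  funext i
  rw [hall i, ← hall j, hu j hj, Pi.zero_apply]

theorem existsUnique_aux (k₁ k₂ : ℝ) (hk₂ : k₂ ≤ 0) (hk : 0 < k₁ + 4 * k₂) (S : Finset ℤ)
    (b g : ℤ → ℝ) :
    ∃! u : ℤ → ℝ, (∀ i, i ∉ S → u i = b i) ∧ ∀ i ∈ S, atomOp k₁ k₂ u i = g i := by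
  classical
  have add : ∀ (u v : ℤ → ℝ) i, atomOp k₁ k₂ (u + v) i = atomOp k₁ k₂ u i + atomOp k₁ k₂ v i := by
    intro u v i
    simp only [atomOp, lap1, lap2, Pi.add_apply]
    ring
  have smul : ∀ (c : ℝ) (u : ℤ → ℝ) i, atomOp k₁ k₂ (c • u) i = c * atomOp k₁ k₂ u i := by
    intro c u i
    simp only [atomOp, lap1, lap2, Pi.smul_apply, smul_eq_mul]
    ring
  let ext : (S → ℝ) →ₗ[ℝ] (ℤ → ℝ) :=
    { toFun := fun x i => if h : i ∈ S then x ⟨i, h⟩ else 0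
      map_add' := fun x y => by
        funext i
        by_cases h : i ∈ S <;> simp [h]
      map_smul' := fun c x => by
        funext i
        by_cases h : i ∈ S <;> simp [h] }
  have ext_off : ∀ x i, i ∉ S → ext x i = 0 := fun x i h => by simp [ext, h]
  have ext_on : ∀ x (i : S), ext x i = x i := fun x i => by simp [ext]
  let φ : (S → ℝ) →ₗ[ℝ] (S → ℝ) :=
    { toFun := fun x i => atomOp k₁ k₂ (ext x) i
      map_add' := fun x y => by
        funext i
        simp only [map_add, add, Pi.add_apply]
      map_smul' := fun c x => by
        funext i
        simp only [map_smul, smul, Pi.smul_apply, smul_eq_mul, RingHom.id_apply] }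
  have inj : Function.Injective φ := by
    rw [← LinearMap.ker_eq_bot, LinearMap.ker_eq_bot']
    intro x hx
    have := eq_zero_of_atomOp k₁ k₂ hk₂ hk S (ext x) (ext_off x)
      (fun i hi => congrFun hx ⟨i, hi⟩)
    funext i
    rw [← ext_on x i, this]
    rfl
  obtain ⟨x, hx⟩ := (LinearMap.injective_iff_surjective.mp inj) fun i => g i - atomOp k₁ k₂ b i
  refine ⟨b + ext x, ⟨fun i hi => by simp [ext_off x i hi], fun i hi => ?_⟩, ?_⟩
  · have : atomOp k₁ k₂ (ext x) i = g i - atomOp k₁ k₂ b i := congrFun hx ⟨i, hi⟩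
    rw [add, this]
    ring
  · rintro v ⟨hv1, hv2⟩
    have key := eq_zero_of_atomOp k₁ k₂ hk₂ hk S (v + (-1 : ℝ) • (b + ext x))
      (fun i hi => by simp [hv1 i hi, ext_off x i hi])
      (fun i hi => by
        have : atomOp k₁ k₂ (ext x) i = g i - atomOp k₁ k₂ b i := congrFun hx ⟨i, hi⟩
        rw [add, smul, add, this, hv2 i hi]
        ring)
    funext i
    have := congrFun key i
    simp only [Pi.add_apply, Pi.smul_apply, smul_eq_mul, Pi.zero_apply] at this ⊢
    linarith

/-- Well-posedness of the atomistic subproblem: `atomSub` is its unique solution. -/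
theorem atomSub_iff {k₁ k₂ : ℝ} (hk₂ : k₂ ≤ 0) (hk : 0 < k₁ + 4 * k₂) {L : ℤ} (hL : 3 ≤ L)
    (g : ℤ → ℝ) (θ : ℝ × ℝ) (u : ℤ → ℝ) :
    IsAtomSub k₁ k₂ L g θ u ↔ u = atomSub k₁ k₂ L g θ := by
  have hEU : ∃! u, IsAtomSub k₁ k₂ L g θ u := by
    have := existsUnique_aux k₁ k₂ hk₂ hk (Finset.Icc 2 (L - 2))
      (fun i => if i = L - 1 then θ.1 else if i = L then θ.2 else 0) g
    refine (existsUnique_congr fun u => ?_).mp this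
    constructor
    · rintro ⟨h1, h2⟩
      refine ⟨h2, ?_, ?_, ?_, ?_, fun i hi => ?_⟩
      · rw [h1 0 (by simp), if_neg (by omega), if_neg (by omega)]
      · rw [h1 1 (by simp), if_neg (by omega), if_neg (by omega)]
      · rw [h1 (L - 1) (by rw [Finset.mem_Icc]; omega), if_pos rfl]
      · rw [h1 L (by simp), if_neg (by omega), if_pos rfl]
      · rw [Finset.mem_Icc] at hi
        rw [h1 i (by rw [Finset.mem_Icc]; omega), if_neg (by omega), if_neg (by omega)]
    · rintro ⟨h1, h2, h3, h4, h5, h6⟩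
      refine ⟨fun i hi => ?_, h1⟩
      rw [Finset.mem_Icc] at hi
      split_ifs with ha hb
      · rw [ha, h4]
      · rw [hb, h5]
      · by_cases hc : i ∈ Finset.Icc 0 L
        · rw [Finset.mem_Icc] at hc
          obtain rfl | rfl : i = 0 ∨ i = 1 := by omega
          · exact h2
          · exact h3
        · exact h6 i hc
  have hs : IsAtomSub k₁ k₂ L g θ (atomSub k₁ k₂ L g θ) := Classical.epsilon_spec hEU.exists
  exact ⟨fun h => hEU.unique h hs, fun h => h ▸ hs⟩

/-- Well-posedness of the continuum subproblem: `contSub` is its unique solution. -/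
theorem contSub_iff {k₁ k₂ : ℝ} (hk : 0 < k₁ + 4 * k₂) {K N : ℤ} (hK : K < N - 1)
    (g : ℤ → ℝ) (θ : ℝ) (u : ℤ → ℝ) :
    IsContSub k₁ k₂ K N g θ u ↔ u = contSub k₁ k₂ K N g θ := by
  have hop : ∀ u i, contOp k₁ k₂ u i = atomOp (k₁ + 4 * k₂) 0 u i := fun u i => by
    simp [contOp, atomOp]
  have hEU : ∃! u, IsContSub k₁ k₂ K N g θ u := by
    have := existsUnique_aux (k₁ + 4 * k₂) 0 le_rfl (by linarith) (Finset.Icc (K + 1) (N - 2))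
      (fun i => if i = K then θ else 0) g
    refine (existsUnique_congr fun u => ?_).mp this
    constructor
    · rintro ⟨h1, h2⟩
      refine ⟨fun i hi => by rw [hop, h2 i hi], ?_, ?_, fun i hi => ?_⟩
      · rw [h1 K (by simp), if_pos rfl]
      · rw [h1 (N - 1) (by rw [Finset.mem_Icc]; omega), if_neg (by omega)]
      · rw [Finset.mem_Icc] at hi
        rw [h1 i (by rw [Finset.mem_Icc]; omega), if_neg (by omega)]
    · rintro ⟨h1, h2, h3, h4⟩
      refine ⟨fun i hi => ?_, fun i hi => by rw [← hop, h1 i hi]⟩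
      rw [Finset.mem_Icc] at hi
      split_ifs with ha
      · rw [ha, h2]
      · by_cases hc : i ∈ Finset.Icc K (N - 1)
        · rw [Finset.mem_Icc] at hc
          obtain rfl : i = N - 1 := by omega
          exact h3
        · exact h4 i hc
  have hs : IsContSub k₁ k₂ K N g θ (contSub k₁ k₂ K N g θ) := Classical.epsilon_spec hEU.exists
  exact ⟨fun h => hEU.unique h hs, fun h => h ▸ hs⟩

end AtC

end

noncomputable section

namespace AtC

/-! With `κ = -k₂ / (k₁ + 4 * k₂) > 0` the atomistic operator factors as `A = -k_c Δ₁ (1 - κ Δ₁)`.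
Solutions of `A V = 0` are therefore an affine function plus two boundary layers `r ^ j` and `r ^ (L
- j)`, where `r < 1` solves `κ (1 - r)² = r`; solutions of `C Y = 0` are affine.

Consistency: if the exact traces of `ũ^a` are used as boundary data, the atomistic piece is exact,
and the continuum piece is wrong by `e`, where `C e = k₂ Δ₁² ũ^a` and `e` vanishes at `K` and `N -
1`. A discrete Poincaré inequality bounds `‖e‖` by `(N - K)² ‖Δ₁² ũ^a‖` up to a constant
(`contSub_sum_sq_le`). These traces compete in the minimization, so the optimal mismatch on the
overlap is at most `‖e‖`.

Stability (`overlap_stability`): let `V` be the error of the atomistic piece and `Y` the difference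
of the continuum extensions of the exact and optimal traces. Then `V - Y` has size `W ≤ 2 ‖e‖` on
the overlap, and it must control `V` and `Y` separately. Applying `1 - κ Δ₁` to `V - Y` removes the
layers, so the affine part of the mismatch is bounded, its slope by `W m^(-3/2)` with `m = L - K`;
the layer amplitudes follow. The two affine parts are separated because `V` vanishes at the left end
and `Y` at the right end. Values of order `W L m^(-3/2)` on at most `N` sites produce the factor
`(L/m)² (N/m)`, while the layers have bounded total mass and produce the `1`. -/

/-! ### Norms and sums over lattice intervals. -/

theorem l2norm_sq (σ : Finset ℤ) (u : ℤ → ℝ) : l2norm σ u ^ 2 = ∑ i ∈ σ, u i ^ 2 := by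
  rw [l2norm, Real.sq_sqrt, l2inner]
  · exact Finset.sum_congr rfl fun i _ => (sq (u i)).symm
  · exact Finset.sum_nonneg fun i _ => mul_self_nonneg (u i)

theorem l2norm_nonneg (σ : Finset ℤ) (u : ℤ → ℝ) : 0 ≤ l2norm σ u := Real.sqrt_nonneg _

theorem sum_Icc_eq_sum_range (a : ℤ) (n : ℕ) (F : ℤ → ℝ) :
    ∑ i ∈ Finset.Icc a (a + n), F i = ∑ j ∈ Finset.range (n + 1), F (a + j) := by
  symm
  refine Finset.sum_bij (fun j _ => a + (j : ℤ)) ?_ ?_ ?_ ?_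
  · intro j hj
    simp only [Finset.mem_range, Finset.mem_Icc] at hj ⊢
    omega
  · intro i _ j _ h
    simpa using h
  · intro i hi
    rw [Finset.mem_Icc] at hi
    refine ⟨(i - a).toNat, ?_, ?_⟩
    · rw [Finset.mem_range]
      omega
    · omega
  · intros
    rfl

/-! ### Solutions of the two homogeneous difference equations. -/

theorem exists_decay_rate {κ : ℝ} (hκ : 0 < κ) : ∃ r : ℝ, 0 < r ∧ r < 1 ∧ κ * (1 - r) ^ 2 = r := by
  have hc : ContinuousOn (fun r : ℝ => κ * (1 - r) ^ 2 - r) (Set.Icc 0 1) := by fun_prop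
  obtain ⟨r, ⟨h0, h1⟩, hr⟩ := intermediate_value_Icc' zero_le_one hc
    (show (0 : ℝ) ∈ Set.Icc _ _ by constructor <;> norm_num; exact hκ.le)
  have hr' : κ * (1 - r) ^ 2 - r = 0 := hr
  refine ⟨r, lt_of_le_of_ne h0 ?_, lt_of_le_of_ne h1 ?_, by linarith⟩
  · rintro rfl
    norm_num at hr'
    exact hκ.ne' hr'
  · rintro rfl
    norm_num at hr'

/-- The recurrence is of second order, and its characteristic equation `κ (1 - s)² = s` is invariant
under `s ↦ 1 / s`, so its roots are `r` and `1 / r`. The second mode is written `r ^ (n - j)` to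
keep both modes bounded by one. -/
theorem exp_representation {r κ : ℝ} (h0 : 0 < r) (h1 : r < 1) (hr : κ * (1 - r) ^ 2 = r)
    (n : ℕ) (hn : 1 ≤ n) (E : ℤ → ℝ)
    (hE : ∀ i ∈ Finset.Icc (1 : ℤ) (n - 1), E i = κ * lap1 E i) :
    ∃ c d : ℝ, ∀ j : ℕ, j ≤ n → E j = c * r ^ j + d * r ^ (n - j) := by
  have hκ : 0 < κ := by
    by_contra h
    nlinarith [sq_nonneg (1 - r)]
  have hpos : 0 < r ^ (n - 1) * (1 - r ^ 2) := by
    have : 0 < 1 - r ^ 2 := by nlinarith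
    positivity
  have hpow : r ^ n = r * r ^ (n - 1) := by
    rw [← pow_succ', Nat.sub_add_cancel hn]
  -- Solving for both amplitudes from `E 0` and `E 1`: eliminating `c` leaves `d r ^ (n - 1) (1 -
  -- r²)`.
  set d := (E 1 - r * E 0) / (r ^ (n - 1) * (1 - r ^ 2)) with hd
  have hd' : d * (r ^ (n - 1) * (1 - r ^ 2)) = E 1 - r * E 0 := div_mul_cancel₀ _ hpos.ne'
  refine ⟨E 0 - d * r ^ n, d, fun j => ?_⟩
  induction j using Nat.twoStepInduction with
  | zero =>
    intro _
    simp
  | one =>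
    intro _
    rw [hpow, Nat.cast_one, pow_one]
    linear_combination (-1 : ℝ) * hd'
  | more j ih0 ih1 =>
    intro hj
    have e0 := ih0 (by omega)
    have e1 := ih1 (by omega)
    have := hE ((j : ℤ) + 1) (by rw [Finset.mem_Icc]; omega)
    rw [lap1, show (j : ℤ) + 1 - 1 = (j : ℕ) by ring,
      show (j : ℤ) + 1 + 1 = ((j + 2 : ℕ) : ℤ) by push_cast; ring,
      show (j : ℤ) + 1 = ((j + 1 : ℕ) : ℤ) by push_cast; ring, e0, e1] at this
    obtain ⟨m, hm⟩ : ∃ m, n = j + 2 + m := ⟨n - (j + 2), by omega⟩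
    rw [show n - j = m + 2 by omega, show n - (j + 1) = m + 1 by omega] at this
    rw [show n - (j + 2) = m by omega]
    set c := E 0 - d * r ^ n
    refine mul_left_cancel₀ hκ.ne' ?_
    have aux : κ * (1 + r ^ 2) = (1 + 2 * κ) * r := by linear_combination hr
    linear_combination (-1 : ℝ) * this - (c * r ^ j + d * r ^ m) * aux

theorem affine_of_lap1_eq_zero (a : ℤ) (n : ℕ) (z : ℤ → ℝ)
    (hz : ∀ i ∈ Finset.Icc (a + 1) (a + n - 1), lap1 z i = 0) :
    ∀ j : ℕ, j ≤ n → z (a + j) = z a + j * (z (a + 1) - z a) := by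
  intro j
  induction j using Nat.twoStepInduction with
  | zero =>
    intro _
    simp
  | one =>
    intro _
    simp
  | more j ih0 ih1 =>
    intro hj
    have e0 := ih0 (by omega)
    have e1 := ih1 (by omega)
    have := hz (a + j + 1) (by rw [Finset.mem_Icc]; omega)
    rw [lap1, show a + (j : ℤ) + 1 - 1 = a + j by ring,
      show a + (j : ℤ) + 1 + 1 = a + (j + 2 : ℕ) by push_cast; ring,
      show a + (j : ℤ) + 1 = a + (j + 1 : ℕ) by push_cast; ring, e0, e1] at this
    push_cast at this ⊢
    linear_combination this

/-! ### Affine sums, the discrete Dirichlet problem and geometric sums. -/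

theorem sum_affine_sq (x q : ℝ) (n : ℕ) :
    ∑ j ∈ Finset.range n, (x + q * j) ^ 2
      = n * x ^ 2 + n * (n - 1) * x * q + n * (n - 1) * (2 * n - 1) / 6 * q ^ 2 := by
  induction n with
  | zero => simp
  | succ n ih =>
    rw [Finset.sum_range_succ, ih]
    push_cast
    ring

theorem endpoints_le_sum_affine_sq (x q : ℝ) (n : ℕ) :
    (n + 1) / 6 * (x ^ 2 + (x + q * n) ^ 2) ≤ ∑ j ∈ Finset.range (n + 1), (x + q * j) ^ 2 := by
  rw [sum_affine_sq]
  push_cast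
  have hn : (0 : ℝ) ≤ n := n.cast_nonneg
  -- Six times the difference of the two sides is the sum of this quantity and the next.
  have h : 0 ≤ (n + 1 : ℝ) * (2 * x + n * q) ^ 2 := by positivity
  have h' : 0 ≤ (n + 1 : ℝ) * n * q ^ 2 := by positivity
  nlinarith

/-- The energy argument: summation by parts and Cauchy–Schwarz give `D² ≤ S G` for the sum `D` of
squared differences, and Poincaré gives `S ≤ n² D`; hence `S² ≤ n⁴ S G`, and `S` cancels. -/
theorem sum_sq_le_of_dirichlet (a : ℤ) (n : ℕ) (e g : ℤ → ℝ) (h0 : e a = 0) (hn : e (a + n) = 0)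
    (hg : ∀ i ∈ Finset.Icc (a + 1) (a + n - 1), lap1 e i = g i) :
    ∑ i ∈ Finset.Icc a (a + n), e i ^ 2 ≤ n ^ 4 * ∑ i ∈ Finset.Icc a (a + n), g i ^ 2 := by
  rw [sum_Icc_eq_sum_range a n fun i => e i ^ 2, sum_Icc_eq_sum_range a n fun i => g i ^ 2,
    Finset.sum_range_succ, Finset.sum_range_succ, hn]
  set S := ∑ j ∈ Finset.range n, e (a + j) ^ 2 with hS
  set G := ∑ j ∈ Finset.range n, g (a + j) ^ 2 with hG
  set D := ∑ j ∈ Finset.range n, (e (a + (j + 1 : ℕ)) - e (a + j)) ^ 2 with hD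
  have hS0 : 0 ≤ S := Finset.sum_nonneg fun _ _ => sq_nonneg _
  have hG0 : 0 ≤ G := Finset.sum_nonneg fun _ _ => sq_nonneg _
  have hD0 : 0 ≤ D := Finset.sum_nonneg fun _ _ => sq_nonneg _
  have hDeq : D = -∑ j ∈ Finset.range n, e (a + j) * g (a + j) := by
    -- The right side telescopes. At `j = 0` the equation for `e` is not available, and the value `e
    -- (a - 1)` is irrelevant because `e a = 0` multiplies it.
    have key : ∀ j ∈ Finset.range n, (e (a + (j + 1 : ℕ)) - e (a + j)) ^ 2 + e (a + j) * g (a + j)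
        = e (a + (j + 1 : ℕ)) * (e (a + (j + 1 : ℕ)) - e (a + (j + 1 : ℕ) - 1))
          - e (a + j) * (e (a + j) - e (a + j - 1)) := by
      intro j hj
      rw [Finset.mem_range] at hj
      rw [show a + ((j + 1 : ℕ) : ℤ) - 1 = a + j by push_cast; ring]
      rcases Nat.eq_zero_or_pos j with rfl | hj0
      · simp only [Nat.cast_zero, add_zero, h0]
        ring
      · rw [← hg (a + j) (by rw [Finset.mem_Icc]; omega), lap1,
          show a + ((j + 1 : ℕ) : ℤ) = a + j + 1 by push_cast; ring]
        ring
    have := Finset.sum_congr rfl key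
    rw [Finset.sum_add_distrib, Finset.sum_range_sub
      (fun j : ℕ => e (a + j) * (e (a + j) - e (a + j - 1))), hn] at this
    simp only [Nat.cast_zero, add_zero, h0] at this
    linarith
  have hDSG : D ^ 2 ≤ S * G := by
    rw [hDeq, neg_sq]
    exact Finset.sum_mul_sq_le_sq_mul_sq _ _ _
  have hp : ∀ j ∈ Finset.range n, e (a + j) ^ 2 ≤ n * D := by
    intro j hj
    rw [Finset.mem_range] at hj
    have h1 : e (a + j) = ∑ i ∈ Finset.range j, (e (a + (i + 1 : ℕ)) - e (a + i)) := by
      rw [Finset.sum_range_sub (fun i : ℕ => e (a + i))]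
      simp [h0]
    have h2 := sq_sum_le_card_mul_sum_sq (s := Finset.range j)
      (f := fun i : ℕ => e (a + (i + 1 : ℕ)) - e (a + i))
    rw [← h1, Finset.card_range] at h2
    refine h2.trans ?_
    have h3 : ∑ i ∈ Finset.range j, (e (a + (i + 1 : ℕ)) - e (a + i)) ^ 2 ≤ D :=
      Finset.sum_le_sum_of_subset_of_nonneg (Finset.range_subset_range.2 hj.le)
        fun _ _ _ => sq_nonneg _
    have h4 : (j : ℝ) ≤ n := by exact_mod_cast hj.le
    exact mul_le_mul h4 h3 (Finset.sum_nonneg fun _ _ => sq_nonneg _) (Nat.cast_nonneg _)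
  have hSD : S ≤ n ^ 2 * D := by
    have := Finset.sum_le_card_nsmul _ _ _ hp
    rw [Finset.card_range, nsmul_eq_mul] at this
    linarith
  have hfin : S ≤ n ^ 4 * G := by
    rcases hS0.eq_or_lt with h | h
    · rw [← h]
      positivity
    · refine le_of_mul_le_mul_left ?_ h
      calc S * S ≤ (n ^ 2 * D) * (n ^ 2 * D) := mul_le_mul hSD hSD hS0 (by positivity)
        _ = n ^ 4 * D ^ 2 := by ring
        _ ≤ n ^ 4 * (S * G) := by gcongr
        _ = S * (n ^ 4 * G) := by ring
  have : 0 ≤ (n : ℝ) ^ 4 * g (a + n) ^ 2 := by positivity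
  linarith

theorem sum_pow_le {r : ℝ} (h0 : 0 < r) (h1 : r < 1) (n : ℕ) :
    ∑ j ∈ Finset.range n, r ^ j ≤ 1 / (1 - r) := by
  rw [geom_sum_eq h1.ne, ← neg_div_neg_eq]
  have : 0 < r ^ n := by positivity
  exact div_le_div₀ (by norm_num) (by linarith) (by linarith) (by linarith)

/-- The last term is the smallest of the `n` terms of the geometric sum. -/
theorem nat_mul_pow_pred_le {r : ℝ} (h0 : 0 < r) (h1 : r < 1) (n : ℕ) :
    n * r ^ (n - 1) ≤ 1 / (1 - r) := by
  refine le_trans ?_ (sum_pow_le h0 h1 n)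
  have := Finset.card_nsmul_le_sum (Finset.range n) (fun j => r ^ j) (r ^ (n - 1)) fun j hj => by
    rw [Finset.mem_range] at hj
    exact pow_le_pow_of_le_one h0.le h1.le (by omega)
  rwa [Finset.card_range, nsmul_eq_mul] at this

/-- Layers have a mass bounded independently of `n`, since `(r ^ j)² ≤ r ^ j` sums to at most `1 /
(1 - r)`; only the smooth part pays for the length of the chain. -/
theorem sum_exp_layers_sq_le {r : ℝ} (h0 : 0 < r) (h1 : r < 1) (n : ℕ) (t B c d : ℝ)
    (V : ℕ → ℝ) (z : ℕ → ℝ) (hz : ∀ j ≤ n, |z j| ≤ B)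
    (hc : |c| ≤ t) (hd : |d| ≤ t) (hV : ∀ j ≤ n, V j = z j + c * r ^ j + d * r ^ (n - j)) :
    ∑ j ∈ Finset.range (n + 1), V j ^ 2 ≤ 3 * (n + 1) * B ^ 2 + 6 / (1 - r) * t ^ 2 := by
  have hs := sum_pow_le h0 h1 (n + 1)
  have hrefl : ∑ j ∈ Finset.range (n + 1), r ^ (n - j) = ∑ j ∈ Finset.range (n + 1), r ^ j := by
    simpa using Finset.sum_range_reflect (fun j => r ^ j) (n + 1)
  have hc2 : c ^ 2 ≤ t ^ 2 := sq_le_sq.2 (hc.trans (le_abs_self t))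
  have hd2 : d ^ 2 ≤ t ^ 2 := sq_le_sq.2 (hd.trans (le_abs_self t))
  have hsq : ∀ m : ℕ, (r ^ m) ^ 2 ≤ r ^ m := fun m => by
    have : r ^ m ≤ 1 := pow_le_one₀ h0.le h1.le
    have : 0 < r ^ m := by positivity
    nlinarith
  have hterm : ∀ j ∈ Finset.range (n + 1),
      V j ^ 2 ≤ 3 * B ^ 2 + 3 * t ^ 2 * r ^ j + 3 * t ^ 2 * r ^ (n - j) := by
    intro j hj
    rw [Finset.mem_range] at hj
    rw [hV j (by omega)]
    have a1 : z j ^ 2 ≤ B ^ 2 := sq_le_sq.2 ((hz j (by omega)).trans (le_abs_self B))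
    have a2 : (c * r ^ j) ^ 2 ≤ t ^ 2 * r ^ j := by
      rw [mul_pow]
      exact mul_le_mul hc2 (hsq j) (by positivity) (by positivity)
    have a3 : (d * r ^ (n - j)) ^ 2 ≤ t ^ 2 * r ^ (n - j) := by
      rw [mul_pow]
      exact mul_le_mul hd2 (hsq _) (by positivity) (by positivity)
    nlinarith [sq_nonneg (z j - c * r ^ j), sq_nonneg (z j - d * r ^ (n - j)),
      sq_nonneg (c * r ^ j - d * r ^ (n - j))]
  refine (Finset.sum_le_sum hterm).trans ?_
  rw [Finset.sum_add_distrib, Finset.sum_add_distrib, Finset.sum_const, Finset.card_range,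
    nsmul_eq_mul, ← Finset.mul_sum, ← Finset.mul_sum, hrefl]
  have : 6 * t ^ 2 * ∑ j ∈ Finset.range (n + 1), r ^ j ≤ 6 * t ^ 2 * (1 / (1 - r)) := by gcongr
  have e : 6 / (1 - r) * t ^ 2 = 6 * t ^ 2 * (1 / (1 - r)) := by ring
  rw [e]
  push_cast
  linarith

/-! ### Stability on the overlap. -/

/-- Bounds on the affine part of the difference `w` on the overlap, at and next to its ends. -/
theorem affine_part_bound {κ : ℝ} (hκ : 0 < κ) (K m : ℕ) (hm : 4 ≤ m) (w : ℤ → ℝ) (W x q : ℝ)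
    (hW : 0 ≤ W) (hw : ∑ i ∈ Finset.Icc (K : ℤ) (K + m), w i ^ 2 ≤ W ^ 2)
    (hx : ∀ j : ℕ, j ≤ m - 2 → w (K + 1 + j) - κ * lap1 w (K + 1 + j) = x + q * j) :
    |x| * √m ≤ 12 * (1 + 2 * κ) * W ∧ |x + q * (m - 2 : ℕ)| * √m ≤ 12 * (1 + 2 * κ) * W ∧
      |q| * m * √m ≤ 48 * (1 + 2 * κ) * W := by
  rw [sum_Icc_eq_sum_range _ _ fun i => w i ^ 2] at hw
  obtain ⟨n, rfl⟩ : ∃ n, m = n + 2 := ⟨m - 2, by omega⟩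
  rw [Nat.add_sub_cancel] at hx ⊢
  -- The stencil of `1 - κ Δ₁` reads `w` at three consecutive sites; each shifted window stays
  -- inside the overlap.
  have hsub : ∀ s : ℕ, s ≤ 2 → ∑ j ∈ Finset.range (n + 1), w (K + (s + j : ℕ)) ^ 2 ≤ W ^ 2 := by
    intro s hs
    refine le_trans ?_ hw
    have : ∑ j ∈ Finset.range (n + 1), w (K + (s + j : ℕ)) ^ 2
        = ∑ i ∈ (Finset.range (n + 1)).map (addLeftEmbedding s), w (K + (i : ℕ)) ^ 2 := by
      rw [Finset.sum_map]
      rfl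
    rw [this]
    refine Finset.sum_le_sum_of_subset_of_nonneg (fun i hi => ?_) fun _ _ _ => sq_nonneg _
    simp only [Finset.mem_map, Finset.mem_range, addLeftEmbedding_apply] at hi ⊢
    obtain ⟨a, ha, rfl⟩ := hi
    omega
  have hterm : ∀ j ∈ Finset.range (n + 1), (x + q * j) ^ 2 ≤ 3 * (1 + 2 * κ) ^ 2 *
      (w (K + (0 + j : ℕ)) ^ 2 + w (K + (1 + j : ℕ)) ^ 2 + w (K + (2 + j : ℕ)) ^ 2) := by
    intro j hj
    rw [Finset.mem_range] at hj
    rw [← hx j (by omega), lap1]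
    rw [show (K : ℤ) + 1 + j - 1 = K + (0 + j : ℕ) by push_cast; ring,
      show (K : ℤ) + 1 + j + 1 = K + (2 + j : ℕ) by push_cast; ring,
      show (K : ℤ) + 1 + j = K + (1 + j : ℕ) by push_cast; ring]
    generalize w (K + (0 + j : ℕ)) = a
    generalize w (K + (1 + j : ℕ)) = b
    generalize w (K + (2 + j : ℕ)) = c
    have h1 : (b - κ * (a - 2 * b + c)) ^ 2
        ≤ 3 * (((1 + 2 * κ) * b) ^ 2 + (κ * a) ^ 2 + (κ * c) ^ 2) := by
      nlinarith [sq_nonneg ((1 + 2 * κ) * b + κ * a), sq_nonneg ((1 + 2 * κ) * b + κ * c),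
        sq_nonneg (κ * a - κ * c)]
    have hκ2 : κ ^ 2 ≤ (1 + 2 * κ) ^ 2 := by nlinarith
    have h2 : (κ * a) ^ 2 ≤ (1 + 2 * κ) ^ 2 * a ^ 2 := by rw [mul_pow]; gcongr
    have h3 : (κ * c) ^ 2 ≤ (1 + 2 * κ) ^ 2 * c ^ 2 := by rw [mul_pow]; gcongr
    nlinarith
  have hsum : ∑ j ∈ Finset.range (n + 1), (x + q * j) ^ 2 ≤ 9 * (1 + 2 * κ) ^ 2 * W ^ 2 := by
    refine (Finset.sum_le_sum hterm).trans ?_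
    rw [← Finset.mul_sum, Finset.sum_add_distrib, Finset.sum_add_distrib]
    have := add_le_add (add_le_add (hsub 0 (by omega)) (hsub 1 (by omega))) (hsub 2 le_rfl)
    calc _ ≤ 3 * (1 + 2 * κ) ^ 2 * (W ^ 2 + W ^ 2 + W ^ 2) := by gcongr
      _ = _ := by ring
  have hend := (endpoints_le_sum_affine_sq x q n).trans hsum
  set y := x + q * n with hy
  have hn : (2 : ℝ) ≤ n := by exact_mod_cast (by omega : 2 ≤ n)
  have hmR : ((n + 2 : ℕ) : ℝ) = n + 2 := by push_cast; ring
  rw [hmR]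
  have hQ : √((n : ℝ) + 2) ^ 2 = n + 2 := Real.sq_sqrt (by linarith)
  have hQ0 : 0 ≤ √((n : ℝ) + 2) := Real.sqrt_nonneg _
  set Q := √((n : ℝ) + 2)
  have hB : 0 ≤ 12 * (1 + 2 * κ) * W := by positivity
  have hxy : ((n : ℝ) + 2) * (x ^ 2 + y ^ 2) ≤ 108 * ((1 + 2 * κ) ^ 2 * W ^ 2) := by
    nlinarith [sq_nonneg x, sq_nonneg y]
  have hpos : 0 ≤ (1 + 2 * κ) ^ 2 * W ^ 2 := by positivity
  have bx : |x| * Q ≤ 12 * (1 + 2 * κ) * W := by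
    refine abs_le_of_sq_le_sq' ?_ hB |>.2
    rw [mul_pow, sq_abs, hQ]
    nlinarith [sq_nonneg y]
  have by' : |y| * Q ≤ 12 * (1 + 2 * κ) * W := by
    refine abs_le_of_sq_le_sq' ?_ hB |>.2
    rw [mul_pow, sq_abs, hQ]
    nlinarith [sq_nonneg x]
  refine ⟨bx, by', ?_⟩
  have hq : |q| * n ≤ |x| + |y| := by
    have : q * n = y - x := by rw [hy]; ring
    rw [← abs_of_nonneg (by linarith : (0 : ℝ) ≤ n), ← abs_mul, this]
    have := abs_sub y x
    linarith
  -- `m ≥ 4` means `n ≥ 2`, so `n + 2 ≤ 2 n`.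
  have hq2 : |q| * (n + 2) ≤ 2 * (|x| + |y|) := by nlinarith [abs_nonneg q]
  calc |q| * (n + 2) * Q ≤ 2 * (|x| + |y|) * Q := by gcongr
    _ ≤ _ := by linarith

/-- The relation `hβ` says that the affine mismatch, extrapolated over a distance `t`, equals `α + β
(N - 1)`; in the application this happens at `N - 1`, where the continuum part vanishes. The slope
`q` is known to order `W m^(-3/2)`, and dividing by `N` passes this order on to `β`, using `m < N`
for the other terms. -/
theorem slope_bound (N m : ℕ) (hm : 4 ≤ m) (hmN : m < N) (C W α β x q t : ℝ) (hC : 0 ≤ C)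
    (hW : 0 ≤ W) (hx : |x| * √m ≤ C * W) (hq : |q| * m * √m ≤ C * W)
    (ht0 : 0 ≤ t) (htN : t ≤ N) (hβ : β * (N - 1) = x - α + q * t)
    {ρ B : ℝ} (hB : 0 ≤ B)
    (hα : |α| * √m ≤ ρ * (|β| * √m) + B * W) (hN : 2 * ρ ≤ N - 1) :
    |β| * m * √m ≤ 4 * (2 * C + B) * W := by
  have hm' : (4 : ℝ) ≤ m := by exact_mod_cast hm
  have hmN' : (m : ℝ) + 1 ≤ N := by exact_mod_cast hmN
  have hQ0 : 0 ≤ √(m : ℝ) := Real.sqrt_nonneg _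
  set Q := √(m : ℝ)
  have h1 : |β| * (N - 1) ≤ |x| + |α| + |q| * N := by
    have e : |β| * (N - 1) = |x - α + q * t| := by
      rw [← hβ, abs_mul, abs_of_nonneg (by linarith : (0 : ℝ) ≤ N - 1)]
    rw [e]
    refine (abs_add_le _ _).trans (add_le_add (abs_sub _ _) ?_)
    rw [abs_mul, abs_of_nonneg ht0]
    gcongr
  have hb0 : 0 ≤ |β| * Q := by positivity
  have h2 : |β| * Q * (N - 1) ≤ C * W + (ρ * (|β| * Q) + B * W) + |q| * Q * N := by
    have := mul_le_mul_of_nonneg_right h1 hQ0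
    nlinarith
  -- The condition on `ρ` lets half of the left side of `h2` absorb the `ρ` term, and `(N - 1) / 2 ≥
  -- N / 4`.
  have h3 : |β| * Q * N ≤ 4 * (C * W + B * W + |q| * Q * N) := by
    have h5 : ρ * (|β| * Q) ≤ (N - 1) / 2 * (|β| * Q) := by gcongr; linarith
    have : |β| * Q * ((N : ℝ) / 4) ≤ |β| * Q * ((N - 1) / 2) :=
      mul_le_mul_of_nonneg_left (by linarith) hb0
    nlinarith
  have h4 : (|β| * m * Q) * N ≤ (4 * (2 * C + B) * W) * N := by
    have a1 : (|β| * Q * N) * m ≤ 4 * (C * W + B * W + |q| * Q * N) * m := by gcongr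
    have a2 : (|q| * m * Q) * N ≤ C * W * N := by gcongr
    have a3 : (C * W + B * W) * m ≤ (C * W + B * W) * N := by gcongr
    nlinarith
  exact le_of_mul_le_mul_right h4 (by linarith)

/-- Control of the affine part `α + β i` of the atomistic displacement. -/
theorem exists_affine_coeff_bound {r : ℝ} (h0 : 0 < r) (h1 : r < 1) {C : ℝ} (hC : 0 ≤ C) :
    ∃ C' : ℝ, 0 ≤ C' ∧ ∀ (K m L N : ℕ) (W α β c d x q t : ℝ), 4 ≤ m → L = K + m → L < N → 0 ≤ W →
      |x| * √m ≤ C * W → |q| * m * √m ≤ C * W → |d| ≤ C * W → |c| * r ^ K ≤ C * W →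
      α + c + d * r ^ L = 0 → α + β + c * r + d * r ^ (L - 1) = 0 →
      0 ≤ t → t ≤ N → β * (N - 1) = x - α + q * t →
      |α| * √m ≤ C' * W ∧ |β| * m * √m ≤ C' * W := by
  set ρ := 1 / (1 - r) with hρ
  have hρ0 : 0 < ρ := by
    have : 0 < 1 - r := by linarith
    positivity
  have hρr : ρ * (1 - r) = 1 := by rw [hρ]; exact one_div_mul_cancel (by linarith)
  -- Chains with `N - 1 < 2 ρ` satisfy `N ≤ n₀`. For these finitely many lengths crude bounds
  -- suffice; longer chains allow the absorption in `slope_bound`.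
  obtain ⟨n₀, hn₀⟩ := exists_nat_ge (2 * ρ + 1)
  set R := (r ^ n₀)⁻¹ with hR
  have hRpos : 0 < R := by positivity
  set B₁ := 2 * ρ * C with hB₁
  set B₂ := n₀ * (C * R + C) with hB₂
  have hB₁0 : 0 ≤ B₁ := by positivity
  have hB₂0 : 0 ≤ B₂ := by positivity
  refine ⟨(ρ + 1) * (4 * (2 * C + B₁)) + B₁ + B₂ + 4 * (2 * C + B₂), by positivity, ?_⟩
  intro K m L N W α β c d x q t hm hL hLN hW hx hq hd hc e0 e1 ht0 htN hβ
  have hm' : (4 : ℝ) ≤ m := by exact_mod_cast hm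
  have hmL : (m : ℝ) ≤ L := by exact_mod_cast (by omega : m ≤ L)
  have hLN' : (L : ℝ) + 1 ≤ N := by exact_mod_cast hLN
  have hQ : √(m : ℝ) ≤ m := by
    rw [Real.sqrt_le_left (by linarith)]
    nlinarith
  have hQ0 : 0 ≤ √(m : ℝ) := Real.sqrt_nonneg _
  have hbq : |β| * √m ≤ |β| * m * √m := by
    gcongr
    nlinarith [abs_nonneg β]
  by_cases hN : 2 * ρ ≤ N - 1
  · have hpow : r ^ L = r * r ^ (L - 1) := by rw [← pow_succ', Nat.sub_add_cancel (by omega)]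
    -- Eliminating `c` from the two conditions at the left end, because only `|c| r ^ K` is
    -- controlled.
    have hα : α = -(ρ * β) - d * r ^ (L - 1) * (1 + r) := by
      rw [hpow] at e0
      have : (1 - r) * α = -β - d * r ^ (L - 1) * (1 + r) * (1 - r) := by
        linear_combination e1 - r * e0
      linear_combination ρ * this - (α + d * r ^ (L - 1) * (1 + r)) * hρr
    -- `d` is bounded by `W` without a gain of `m^(-1/2)`; its exponentially small value at the left
    -- end supplies that gain.
    have hlay : √(m : ℝ) * r ^ (L - 1) ≤ ρ := by
      refine le_trans ?_ (nat_mul_pow_pred_le h0 h1 L)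
      gcongr
      linarith
    have hαb : |α| * √m ≤ ρ * (|β| * √m) + B₁ * W := by
      have h2 : |α| ≤ ρ * |β| + |d| * r ^ (L - 1) * 2 := by
        rw [hα]
        refine (abs_sub _ _).trans (add_le_add ?_ ?_)
        · rw [abs_neg, abs_mul, abs_of_pos hρ0]
        · rw [abs_mul, abs_mul, abs_of_nonneg (by positivity : 0 ≤ r ^ (L - 1)),
            abs_of_nonneg (by linarith : 0 ≤ 1 + r)]
          gcongr
          linarith
      have h3 : |d| * (√m * r ^ (L - 1)) ≤ C * W * ρ := by gcongr
      have := mul_le_mul_of_nonneg_right h2 hQ0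
      rw [hB₁]
      linarith
    have hb := slope_bound N m hm (by omega) C W α β x q t hC hW hx hq ht0 htN hβ hB₁0 hαb hN
    have p1 : 0 ≤ B₂ * W := by positivity
    have p2 : 0 ≤ B₁ * W := by positivity
    have p3 : 0 ≤ C * W := by positivity
    have p4 : 0 ≤ ρ * (4 * (2 * C + B₁) * W) := by positivity
    constructor
    · have := mul_le_mul_of_nonneg_left (hbq.trans hb) hρ0.le
      linarith
    · linarith
  · have hNn : N ≤ n₀ := by
      have : (N : ℝ) ≤ n₀ := by linarith
      exact_mod_cast this
    have hrK : r ^ n₀ ≤ r ^ K := pow_le_pow_of_le_one h0.le h1.le (by omega)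
    have hcb : |c| ≤ C * W * R := by
      rw [hR, ← div_eq_mul_inv, le_div_iff₀ (by positivity)]
      exact le_trans (by gcongr) hc
    -- Here `r ^ K ≥ r ^ n₀`, so `c` itself is bounded and `α` needs no `β` term: `slope_bound`
    -- applies with `ρ = 0`.
    have hαb : |α| * √m ≤ 0 * (|β| * √m) + B₂ * W := by
      have h2 : |α| ≤ |c| + |d| := by
        rw [show α = -c - d * r ^ L by linear_combination e0]
        refine (abs_sub _ _).trans (add_le_add (abs_neg c).le ?_)
        rw [abs_mul, abs_of_nonneg (by positivity : 0 ≤ r ^ L)]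
        exact mul_le_of_le_one_right (abs_nonneg d) (pow_le_one₀ h0.le h1.le)
      have h3 : √(m : ℝ) ≤ n₀ := hQ.trans (by exact_mod_cast (by omega : m ≤ n₀))
      have : |α| * √m ≤ (C * W * R + C * W) * n₀ :=
        mul_le_mul (h2.trans (add_le_add hcb hd)) h3 hQ0 (by positivity)
      rw [hB₂]
      linarith
    have hb := slope_bound N m hm (by omega) C W α β x q t hC hW hx hq ht0 htN hβ hB₂0 hαb
      (by linarith)
    have p1 : 0 ≤ B₂ * W := by positivity
    have p2 : 0 ≤ B₁ * W := by positivity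
    have p3 : 0 ≤ C * W := by positivity
    have p4 : 0 ≤ ρ * (4 * (2 * C + B₁) * W) := by positivity
    constructor <;> linarith

/-- `z = V - κ Δ₁ V` is discretely harmonic, hence affine. Since `Δ₁ z = 0`, `V - z` satisfies `E =
κ Δ₁ E` and consists of two layers. -/
theorem atomic_representation {r κ : ℝ} (h0 : 0 < r) (h1 : r < 1) (hr : κ * (1 - r) ^ 2 = r)
    (L : ℕ) (hL : 5 ≤ L) (V : ℤ → ℝ)
    (hV : ∀ i ∈ Finset.Icc (2 : ℤ) (L - 2), lap1 (fun j => V j - κ * lap1 V j) i = 0) :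
    ∃ α β c d : ℝ, (∀ j : ℕ, 1 ≤ j → j < L → V j - κ * lap1 V j = α + β * j) ∧
      ∀ j : ℕ, j ≤ L → V j = α + β * j + c * r ^ j + d * r ^ (L - j) := by
  have haff := affine_of_lap1_eq_zero 1 (L - 2) (fun j => V j - κ * lap1 V j) (fun i hi => by
    rw [Finset.mem_Icc] at hi
    exact hV i (by rw [Finset.mem_Icc]; omega))
  set z : ℤ → ℝ := fun j => V j - κ * lap1 V j with hz
  set β := z (1 + 1) - z 1
  set α := z 1 - β
  have hzα : ∀ j : ℕ, 1 ≤ j → j < L → V j - κ * lap1 V j = α + β * j := by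
    intro j hj hjL
    have := haff (j - 1) (by omega)
    rw [show (1 : ℤ) + (j - 1 : ℕ) = j by omega, Nat.cast_sub hj] at this
    rw [this, Nat.cast_one]
    simp only [α, hz]
    ring
  obtain ⟨c, d, hcd⟩ := exp_representation h0 h1 hr L (by omega) (fun i => V i - (α + β * i)) (by
    intro i hi
    rw [Finset.mem_Icc] at hi
    have := hzα i.toNat (by omega) (by omega)
    rw [← Int.cast_natCast (R := ℝ) i.toNat, Int.toNat_of_nonneg (by omega)] at this
    have hl : lap1 (fun i : ℤ => V i - (α + β * i)) i = lap1 V i := by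
      simp only [lap1]
      push_cast
      ring
    rw [hl]
    linarith)
  refine ⟨α, β, c, d, hzα, fun j hj => ?_⟩
  have := hcd j hj
  simp only [Int.cast_natCast] at this
  linarith

/-- Used with `e₀`, `e₁` the layer sums at two neighbouring sites: `e₀ - r e₁` cancels one mode and
leaves `1 - r²` times the other. -/
theorem boundary_layer_bound {r : ℝ} (h0 : 0 < r) (h1 : r < 1) {a b t e₀ e₁ : ℝ}
    (h : t * (1 - r ^ 2) = e₀ - r * e₁) (ha : |e₀| ≤ a) (hb : |e₁| ≤ b) :
    |t| ≤ (a + b) / (1 - r ^ 2) := by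
  have hp : 0 < 1 - r ^ 2 := by nlinarith
  rw [le_div_iff₀ hp]
  nth_rw 1 [← abs_of_pos hp]
  rw [← abs_mul, h]
  refine (abs_sub _ _).trans (add_le_add ha ?_)
  rw [abs_mul, abs_of_pos h0]
  nlinarith [abs_nonneg e₁]

set_option maxHeartbeats 800000 in
/-- A discrete atomistic-harmonic function and a discrete affine one, vanishing at opposite ends of
the chain, are both controlled by their mismatch on the overlap. -/
theorem overlap_stability {κ : ℝ} (hκ : 0 < κ) :
    ∃ C : ℝ, 0 ≤ C ∧ ∀ (K m L N : ℕ) (V Y : ℤ → ℝ) (W : ℝ), 0 < K → 4 ≤ m → L = K + m → L < N →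
      V 0 = 0 → V 1 = 0 →
      (∀ i ∈ Finset.Icc (2 : ℤ) (L - 2), lap1 (fun j => V j - κ * lap1 V j) i = 0) →
      (∀ i ∈ Finset.Icc (K + 1 : ℤ) (N - 2), lap1 Y i = 0) → Y (N - 1) = 0 → 0 ≤ W →
      ∑ i ∈ Finset.Icc (K : ℤ) L, (V i - Y i) ^ 2 ≤ W ^ 2 →
      ∑ i ∈ Finset.Icc (0 : ℤ) L, V i ^ 2 ≤ C * (1 + (L / m : ℝ) ^ 2 * (N / m)) * W ^ 2 ∧
      ∑ i ∈ Finset.Icc (L + 1 : ℤ) (N - 1), Y i ^ 2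
        ≤ C * (1 + (L / m : ℝ) ^ 2 * (N / m)) * W ^ 2 := by
  obtain ⟨r, h0, h1, hr⟩ := exists_decay_rate hκ
  set A := 48 * (1 + 2 * κ) with hA
  have hA0 : 0 ≤ A := by positivity
  have hp : 0 < 1 - r ^ 2 := by nlinarith
  have hp' : 0 < 1 - r := by linarith
  set D := A + (2 + 3 * A) / (1 - r ^ 2) with hD
  have hAD : A ≤ D := by
    have : 0 ≤ (2 + 3 * A) / (1 - r ^ 2) := by positivity
    linarith
  have hD0 : 0 ≤ D := hA0.trans hAD
  obtain ⟨C', hC', hcoef⟩ := exists_affine_coeff_bound h0 h1 hD0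
  refine ⟨12 * C' ^ 2 + 6 / (1 - r) * (C' + D) ^ 2 + 4 * (2 * C' + A) ^ 2, by positivity, ?_⟩
  intro K m L N V Y W hK hm hL hLN hV0 hV1 hV hY hYN hW hVY
  obtain ⟨α, β, c, d, hz, hrep⟩ := atomic_representation h0 h1 hr L (by omega) V hV
  have hYaff := affine_of_lap1_eq_zero K (N - 1 - K) Y (fun i hi => by
    rw [Finset.mem_Icc] at hi
    exact hY i (by rw [Finset.mem_Icc]; omega))
  set s := -(Y (K + 1) - Y K) with hs
  have hYrep : ∀ j : ℕ, K + j ≤ N - 1 → Y (K + j) = s * (N - 1 - (K + j)) := by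
    intro j hj
    have a1 := hYaff j (by omega)
    have a2 := hYaff (N - 1 - K) le_rfl
    rw [show (K : ℤ) + (N - 1 - K : ℕ) = N - 1 by omega, hYN, Nat.sub_sub,
      Nat.cast_sub (by omega)] at a2
    push_cast at a2
    rw [hs]
    linear_combination a1 - a2
  set x := α + β * (K + 1) - s * (N - 2 - K) with hx
  set q := β + s with hq
  have hmR : (m : ℝ) = L - K := by rw [hL]; push_cast; ring
  have hm4 : (4 : ℝ) ≤ m := by exact_mod_cast hm
  have hK1 : (1 : ℝ) ≤ K := by exact_mod_cast hK
  have hLN1 : (L : ℝ) + 1 ≤ N := by exact_mod_cast hLN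
  have hLZ : (L : ℤ) = K + m := by rw [hL]; push_cast; ring
  -- Only the interior sites `K + 1, …, L - 1` of the overlap are used; there `x` is the value of
  -- the affine mismatch at `K + 1` and `q` its slope.
  have hℓ : ∀ j : ℕ, j ≤ m - 2 →
      (V - Y) (K + 1 + j) - κ * lap1 (V - Y) (K + 1 + j) = x + q * j := by
    intro j hj
    have a1 := hz (K + 1 + j) (by omega) (by omega)
    have a2 := hY (K + 1 + j) (by rw [Finset.mem_Icc]; omega)
    have a3 := hYrep (1 + j) (by omega)
    push_cast at a1 a3
    rw [← add_assoc] at a3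
    have a4 : lap1 (V - Y) (K + 1 + j) = lap1 V (K + 1 + j) - lap1 Y (K + 1 + j) := by
      simp only [lap1, Pi.sub_apply]
      ring
    rw [a4, a2, Pi.sub_apply, a3, hx, hq]
    linear_combination a1
  have hVY' : ∑ i ∈ Finset.Icc (K : ℤ) (K + m), (V - Y) i ^ 2 ≤ W ^ 2 := by
    rw [← hLZ]
    exact hVY
  obtain ⟨bx, bye, bq⟩ := affine_part_bound hκ K m hm (V - Y) W x q hW hVY' hℓ
  set y := x + q * (m - 2 : ℕ) with hy
  have hyx : y = x + q * (m - 2) := by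
    rw [hy, Nat.cast_sub (by omega)]
    norm_num
  have hQ1 : 1 ≤ √(m : ℝ) := by
    rw [Real.one_le_sqrt]
    linarith
  have hQ2 : √(m : ℝ) ^ 2 = m := Real.sq_sqrt (by linarith)
  set Q := √(m : ℝ)
  have hle : ∀ a : ℝ, |a| ≤ |a| * Q := fun a => le_mul_of_one_le_right (abs_nonneg a) hQ1
  have hκW : 0 ≤ (1 + 2 * κ) * W := by positivity
  have bxA : |x| * Q ≤ A * W := by rw [hA]; linarith
  have bqA : |q| * m * Q ≤ A * W := by rw [hA]; linarith
  have bx1 : |x| ≤ A * W := (hle x).trans bxA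
  have by1 : |y| ≤ A * W := by
    have := hle y
    rw [hA]
    linarith
  have bq1 : |q| ≤ A * W := by
    have : |q| ≤ |q| * m := le_mul_of_one_le_right (abs_nonneg q) (by linarith)
    have h2 : |q| * m ≤ |q| * m * Q := le_mul_of_one_le_right (by positivity) hQ1
    linarith
  have hpt : ∀ j : ℕ, j ≤ m → |V (K + j) - Y (K + j)| ≤ W := by
    intro j hj
    refine abs_le_of_sq_le_sq' ?_ hW |> abs_le.2
    refine le_trans ?_ hVY
    exact Finset.single_le_sum (f := fun i => (V i - Y i) ^ 2) (fun _ _ => sq_nonneg _)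
      (by rw [Finset.mem_Icc]; omega)
  have hE : ∀ j : ℕ, j ≤ m →
      c * r ^ (K + j) + d * r ^ (m - j) = (V (K + j) - Y (K + j)) - (x + q * (j - 1)) := by
    intro j hj
    have a1 := hrep (K + j) (by omega)
    rw [show L - (K + j) = m - j by omega] at a1
    push_cast at a1
    rw [a1, hYrep j (by omega), hx, hq]
    ring
  -- The last two sites of the overlap isolate the right layer, and below the first two isolate the
  -- left one. The latter gives only its amplitude `c r ^ K` as seen from the overlap.
  have bd : |d| ≤ D * W := by
    have e₀ := hE m le_rfl
    have e₁ := hE (m - 1) (by omega)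
    rw [Nat.sub_self, pow_zero] at e₀
    rw [show m - (m - 1) = 1 by omega, pow_one] at e₁
    have hpw : r ^ (K + m) = r * r ^ (K + (m - 1)) := by
      rw [← pow_succ', show K + (m - 1) + 1 = K + m by omega]
    have hb0 := hpt m le_rfl
    have hb1 := hpt (m - 1) (by omega)
    rw [Nat.cast_sub (R := ℝ) (by omega)] at e₁
    push_cast at e₁
    have key := boundary_layer_bound h0 h1 (t := d) (a := W + 2 * A * W) (b := W + A * W)
      (e₀ := (V (K + m) - Y (K + m)) - (x + q * (m - 1)))
      (e₁ := (V (K + (m - 1 : ℕ)) - Y (K + (m - 1 : ℕ))) - (x + q * (m - 1 - 1)))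
      (by rw [← e₀, ← e₁, hpw]; ring)
      (by
        rw [show x + q * ((m : ℝ) - 1) = y + q by rw [hyx]; ring]
        have := abs_sub (V (K + m) - Y (K + m)) (y + q)
        have := abs_add_le y q
        linarith)
      (by
        rw [show x + q * ((m : ℝ) - 1 - 1) = y by rw [hyx]; ring]
        have := abs_sub (V (K + (m - 1 : ℕ)) - Y (K + (m - 1 : ℕ))) y
        linarith)
    have : D * W = A * W + (W + 2 * A * W + (W + A * W)) / (1 - r ^ 2) := by rw [hD]; ring
    rw [this]
    have : 0 ≤ A * W := by positivity
    linarith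
  have bc : |c| * r ^ K ≤ D * W := by
    have e₀ := hE 0 (by omega)
    have e₁ := hE 1 (by omega)
    rw [Nat.sub_zero, add_zero] at e₀
    have hpw : r ^ m = r * r ^ (m - 1) := by
      rw [← pow_succ', show m - 1 + 1 = m by omega]
    have hb0 := hpt 0 (by omega)
    have hb1 := hpt 1 (by omega)
    have key := boundary_layer_bound h0 h1 (t := c * r ^ K) (a := W + 2 * A * W) (b := W + A * W)
      (e₀ := (V (K + (0 : ℕ)) - Y (K + (0 : ℕ))) - (x + q * ((0 : ℕ) - 1)))
      (e₁ := (V (K + (1 : ℕ)) - Y (K + (1 : ℕ))) - (x + q * ((1 : ℕ) - 1)))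
      (by rw [← e₀, ← e₁, hpw, pow_succ]; ring)
      (by
        rw [show x + q * (((0 : ℕ) : ℝ) - 1) = x - q by push_cast; ring]
        have := abs_sub (V (K + (0 : ℕ)) - Y (K + (0 : ℕ))) (x - q)
        have := abs_sub x q
        linarith)
      (by
        rw [show x + q * (((1 : ℕ) : ℝ) - 1) = x by push_cast; ring]
        have := abs_sub (V (K + (1 : ℕ)) - Y (K + (1 : ℕ))) x
        linarith)
    have : D * W = A * W + (W + 2 * A * W + (W + A * W)) / (1 - r ^ 2) := by rw [hD]; ring
    rw [this]
    have : 0 ≤ A * W := by positivity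
    rw [abs_mul, abs_of_pos (by positivity : 0 < r ^ K)] at key
    linarith
  have bc0 : α + c + d * r ^ L = 0 := by
    have := hrep 0 (by omega)
    rw [Nat.cast_zero, hV0] at this
    simp only [Nat.cast_zero, pow_zero, Nat.sub_zero] at this
    linarith
  have bc1 : α + β + c * r + d * r ^ (L - 1) = 0 := by
    have := hrep 1 (by omega)
    rw [Nat.cast_one, hV1] at this
    simp only [Nat.cast_one, pow_one] at this
    linarith
  have hADW : A * W ≤ D * W := by gcongr
  set t : ℝ := N - 2 - K with ht
  have ht0 : 0 ≤ t := by rw [ht]; linarith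
  obtain ⟨bα, bβ⟩ := hcoef K m L N W α β c d x q t hm hL hLN hW (bxA.trans hADW) (bqA.trans hADW)
    bd bc bc0 bc1 ht0 (by rw [ht]; linarith) (by rw [hx, hq, ht]; ring)
  have hLm : 1 ≤ (L / m : ℝ) := by
    rw [one_le_div (by linarith)]
    linarith
  have hmL : (m : ℝ) * (L / m) = L := by field_simp
  -- This `γ` is the reciprocal of the overlap fraction in the main theorem.
  set γ := (L / m : ℝ) with hγ
  have hNm : 0 ≤ (N / m : ℝ) := by positivity
  have hmN : (m : ℝ) * (N / m) = N := by field_simp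
  set ν := (N / m : ℝ)
  have hC'W : 0 ≤ C' * W := by positivity
  have bβL : |β| * L * Q ≤ C' * W * γ := by
    rw [← hmL]
    have := mul_le_mul_of_nonneg_right bβ (by linarith : 0 ≤ γ)
    linarith
  have bαγ : |α| * Q ≤ C' * W * γ := bα.trans (le_mul_of_one_le_right hC'W hLm)
  have bxγ : |x| * Q ≤ A * W * γ := bxA.trans (le_mul_of_one_le_right (by positivity) hLm)
  have sq_of : ∀ b c₀ : ℝ, 0 ≤ b → b * Q ≤ c₀ * W * γ → N * b ^ 2 ≤ c₀ ^ 2 * (γ ^ 2 * ν) * W ^ 2 := by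
    intro b c₀ hb h
    have h2 : (b * Q) ^ 2 ≤ (c₀ * W * γ) ^ 2 := pow_le_pow_left₀ (by positivity) h 2
    rw [mul_pow, hQ2] at h2
    rw [← hmN]
    have := mul_le_mul_of_nonneg_left h2 hNm
    linarith
  have hg0 : 0 ≤ γ ^ 2 * ν := by positivity
  constructor
  · have hcW : |c| ≤ (C' + D) * W := by
      rw [show c = -α - d * r ^ L by linear_combination bc0]
      refine (abs_sub _ _).trans ?_
      rw [abs_neg, abs_mul, abs_of_pos (by positivity : 0 < r ^ L), add_mul]
      refine add_le_add ((hle α).trans bα) (le_trans ?_ bd)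
      exact mul_le_of_le_one_right (abs_nonneg d) (pow_le_one₀ h0.le h1.le)
    have hdW : |d| ≤ (C' + D) * W := by linarith
    have key := sum_exp_layers_sq_le h0 h1 L ((C' + D) * W) (|α| + |β| * L) c d (fun j => V j)
      (fun j => α + β * j) (fun j hj => by
        refine (abs_add_le _ _).trans ?_
        rw [abs_mul, Nat.abs_cast]
        gcongr) hcW hdW hrep
    have hsum := sum_Icc_eq_sum_range 0 L fun i => V i ^ 2
    simp only [zero_add] at hsum
    rw [hsum]
    refine key.trans ?_
    have h2 := sq_of (|α| + |β| * L) (2 * C') (by positivity) (by linarith)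
    have h3 : 3 * ((L : ℝ) + 1) * (|α| + |β| * L) ^ 2 ≤ 3 * N * (|α| + |β| * L) ^ 2 := by gcongr
    have p1 : 0 ≤ 12 * C' ^ 2 * W ^ 2 := by positivity
    have p2 : 0 ≤ 6 / (1 - r) * (C' + D) ^ 2 * (γ ^ 2 * ν) * W ^ 2 := by positivity
    have p3 : 0 ≤ 4 * (2 * C' + A) ^ 2 * (1 + γ ^ 2 * ν) * W ^ 2 := by positivity
    have e : (12 * C' ^ 2 + 6 / (1 - r) * (C' + D) ^ 2 + 4 * (2 * C' + A) ^ 2) * (1 + γ ^ 2 * ν)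
          * W ^ 2
        = 12 * C' ^ 2 * W ^ 2 + 3 * ((2 * C') ^ 2 * (γ ^ 2 * ν) * W ^ 2)
          + 6 / (1 - r) * ((C' + D) * W) ^ 2 + 6 / (1 - r) * (C' + D) ^ 2 * (γ ^ 2 * ν) * W ^ 2
          + 4 * (2 * C' + A) ^ 2 * (1 + γ ^ 2 * ν) * W ^ 2 := by ring
    rw [e]
    linarith
  · have hst : |s| * t * Q ≤ (2 * C' + A) * W * γ := by
      -- `s t` is the value of `Y` at `K + 1`. Comparing with the affine part of `V` there
      -- multiplies `β` by `K + 1 ≤ L` rather than by `N`.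
      have e : |s| * t = |β * (K + 1) + α - x| := by
        nth_rw 1 [← abs_of_nonneg ht0]
        rw [← abs_mul, hx]
        congr 1
        ring
      have h2 : |s| * t ≤ |β| * L + |α| + |x| := by
        rw [e]
        refine (abs_sub _ _).trans (add_le_add ((abs_add_le _ _).trans (add_le_add ?_ le_rfl)) le_rfl)
        rw [abs_mul, abs_of_nonneg (by positivity : (0 : ℝ) ≤ K + 1)]
        gcongr
        linarith
      have := mul_le_mul_of_nonneg_right h2 (by positivity : 0 ≤ Q)
      linarith
    have h2 := sq_of (|s| * t) (2 * C' + A) (by positivity) hst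
    have hpt : ∀ i ∈ Finset.Icc (L + 1 : ℤ) (N - 1), Y i ^ 2 ≤ 4 * (|s| * t) ^ 2 := by
      intro i hi
      rw [Finset.mem_Icc] at hi
      have a1 := hYrep (i - K).toNat (by omega)
      rw [Int.toNat_of_nonneg (by omega), add_sub_cancel] at a1
      rw [← Int.cast_natCast (R := ℝ) (i - K).toNat, Int.toNat_of_nonneg (by omega)] at a1
      push_cast at a1
      have hi1 : (L : ℝ) + 1 ≤ i := by exact_mod_cast hi.1
      have hi2 : (i : ℝ) ≤ N - 1 := by exact_mod_cast hi.2
      rw [a1, add_sub_cancel, mul_pow, mul_pow, sq_abs]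
      have : ((N : ℝ) - 1 - i) ^ 2 ≤ (2 * t) ^ 2 :=
        pow_le_pow_left₀ (by linarith) (by rw [ht]; linarith) 2
      calc s ^ 2 * ((N : ℝ) - 1 - i) ^ 2 ≤ s ^ 2 * (2 * t) ^ 2 := by gcongr
        _ = 4 * (s ^ 2 * t ^ 2) := by ring
    have h3 := Finset.sum_le_card_nsmul _ _ _ hpt
    rw [nsmul_eq_mul, Int.card_Icc] at h3
    have hcard : (((N : ℤ) - 1 + 1 - (L + 1)).toNat : ℝ) ≤ N := by
      exact_mod_cast (by omega : ((N : ℤ) - 1 + 1 - (L + 1)).toNat ≤ N)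
    refine h3.trans ?_
    have h4 : (((N : ℤ) - 1 + 1 - (L + 1)).toNat : ℝ) * (4 * (|s| * t) ^ 2)
        ≤ N * (4 * (|s| * t) ^ 2) := by gcongr
    have p1 : 0 ≤ 4 * (2 * C' + A) ^ 2 * W ^ 2 := by positivity
    have p2 : 0 ≤ 6 / (1 - r) * (C' + D) ^ 2 * (1 + γ ^ 2 * ν) * W ^ 2 := by positivity
    have p3 : 0 ≤ 12 * C' ^ 2 * (1 + γ ^ 2 * ν) * W ^ 2 := by positivity
    have e : (12 * C' ^ 2 + 6 / (1 - r) * (C' + D) ^ 2 + 4 * (2 * C' + A) ^ 2) * (1 + γ ^ 2 * ν)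
          * W ^ 2
        = 12 * C' ^ 2 * (1 + γ ^ 2 * ν) * W ^ 2 + 4 * (2 * C' + A) ^ 2 * W ^ 2
          + 6 / (1 - r) * (C' + D) ^ 2 * (1 + γ ^ 2 * ν) * W ^ 2
          + 4 * ((2 * C' + A) ^ 2 * (γ ^ 2 * ν) * W ^ 2) := by ring
    rw [e]
    linarith

/-! ### Operator identities, consistency and the coupling error. -/

theorem atomOp_eq_lap1 {k₁ k₂ : ℝ} (hk : k₁ + 4 * k₂ ≠ 0) (u : ℤ → ℝ) (i : ℤ) :
    atomOp k₁ k₂ u i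
      = -((k₁ + 4 * k₂) * lap1 (fun j => u j - -k₂ / (k₁ + 4 * k₂) * lap1 u j) i) := by
  simp only [atomOp, lap1, lap2, show i - 1 - 1 = i - 2 by ring, show i + 1 + 1 = i + 2 by ring,
    show i - 1 + 1 = i by ring, show i + 1 - 1 = i by ring]
  have h : (k₁ + 4 * k₂) * (-k₂ / (k₁ + 4 * k₂)) = -k₂ := mul_div_cancel₀ _ hk
  linear_combination (-(u (i - 2) - 4 * u (i - 1) + 6 * u i - 4 * u (i + 1) + u (i + 2))) * h

theorem contOp_eq_atomOp_add (k₁ k₂ : ℝ) (u : ℤ → ℝ) (i : ℤ) :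
    contOp k₁ k₂ u i = atomOp k₁ k₂ u i + k₂ * lap1 (lap1 u) i := by
  simp only [contOp, atomOp, lap1, lap2, show i - 1 - 1 = i - 2 by ring,
    show i + 1 + 1 = i + 2 by ring, show i - 1 + 1 = i by ring, show i + 1 - 1 = i by ring]
  ring

theorem isAtomSub_atomSub {k₁ k₂ : ℝ} (hk₂ : k₂ ≤ 0) (hk : 0 < k₁ + 4 * k₂) {L : ℤ} (hL : 3 ≤ L)
    (g : ℤ → ℝ) (θ : ℝ × ℝ) : IsAtomSub k₁ k₂ L g θ (atomSub k₁ k₂ L g θ) :=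
  (atomSub_iff hk₂ hk hL g θ _).2 rfl

theorem isContSub_contSub {k₁ k₂ : ℝ} (hk : 0 < k₁ + 4 * k₂) {K N : ℤ} (hK : K < N - 1)
    (g : ℤ → ℝ) (θ : ℝ) : IsContSub k₁ k₂ K N g θ (contSub k₁ k₂ K N g θ) :=
  (contSub_iff hk hK g θ _).2 rfl

theorem reducedObjective_eq (k₁ k₂ : ℝ) (K L N : ℤ) (f : ℤ → ℝ) (θ : (ℝ × ℝ) × ℝ) :
    reducedObjective k₁ k₂ K L N f θ = 1 / 2 * ∑ i ∈ Finset.Icc K L,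
      ((ua0 k₁ k₂ L f i + va k₁ k₂ L θ.1 i) - (uc0 k₁ k₂ K N f i + vc k₁ k₂ K N θ.2 i)) ^ 2 := by
  rw [reducedObjective, l2norm_sq, l2norm_sq, l2inner, Finset.mul_sum, Finset.mul_sum,
    ← Finset.sum_add_distrib, ← Finset.sum_add_distrib, Finset.mul_sum]
  refine Finset.sum_congr rfl fun i _ => ?_
  simp only [Pi.sub_apply]
  ring

theorem ua0_add_va_trace {k₁ k₂ : ℝ} (hk₂ : k₂ ≤ 0) (hk : 0 < k₁ + 4 * k₂) {L N : ℤ} (hL : 3 ≤ L)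
    (hLN : L ≤ N) {f u : ℤ → ℝ} (hu : IsAtomisticSolution k₁ k₂ N f u) :
    ∀ i ∈ Finset.Icc 0 L, ua0 k₁ k₂ L f i + va k₁ k₂ L (u (L - 1), u L) i = u i := by
  classical
  have ha := isAtomSub_atomSub hk₂ hk hL f 0
  have key := (atomSub_iff hk₂ hk hL 0 (u (L - 1), u L)
    (fun i => if i ∈ Finset.Icc 0 L then u i - ua0 k₁ k₂ L f i else 0)).1 (by
      have h0 := ha.left0
      have h1 := ha.left1
      have h2 := ha.right1
      have h3 := ha.right0
      refine ⟨fun i hi => ?_, ?_, ?_, ?_, ?_, fun i hi => if_neg hi⟩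
      · have e1 := ha.eq i hi
        rw [Finset.mem_Icc] at hi
        have e2 := hu.2 i (by rw [Finset.mem_Icc]; omega)
        simp only [atomOp, lap1, lap2] at e1 e2 ⊢
        rw [if_pos (by rw [Finset.mem_Icc]; omega), if_pos (by rw [Finset.mem_Icc]; omega),
          if_pos (by rw [Finset.mem_Icc]; omega), if_pos (by rw [Finset.mem_Icc]; omega),
          if_pos (by rw [Finset.mem_Icc]; omega)]
        simp only [ua0, Pi.zero_apply]
        linarith
      · rw [if_pos (by rw [Finset.mem_Icc]; omega), ua0, h0, hu.1.1, sub_zero]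
      · rw [if_pos (by rw [Finset.mem_Icc]; omega), ua0, h1, hu.1.2.1, sub_zero]
      · rw [if_pos (by rw [Finset.mem_Icc]; omega), ua0, h2]
        exact sub_zero _
      · rw [if_pos (by rw [Finset.mem_Icc]; omega), ua0, h3]
        exact sub_zero _)
  intro i hi
  rw [va, ← key]
  simp only [if_pos hi]
  ring

/-- `C u = A u + k₂ Δ₁² u = f + k₂ Δ₁² u` inside, so subtracting the Dirichlet solution with force
`k₂ Δ₁² u` leaves a solution of the continuum problem with the same boundary values; uniqueness
identifies it. -/
theorem uc0_add_vc_trace {k₁ k₂ : ℝ} (hk : 0 < k₁ + 4 * k₂) {K N : ℤ} (hK : 0 < K) (hKN : K < N - 1)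
    {f u : ℤ → ℝ} (hu : IsAtomisticSolution k₁ k₂ N f u) :
    ∀ i ∈ Finset.Icc K (N - 1), uc0 k₁ k₂ K N f i + vc k₁ k₂ K N (u K) i
      = u i - contSub k₁ k₂ K N (fun i => k₂ * lap1Sq N u i) 0 i := by
  classical
  have ha := isContSub_contSub hk hKN f 0
  have he := isContSub_contSub hk hKN (fun i => k₂ * lap1Sq N u i) 0
  set e := contSub k₁ k₂ K N (fun i => k₂ * lap1Sq N u i) 0
  have key := (contSub_iff hk hKN 0 (u K)
    (fun i => if i ∈ Finset.Icc K (N - 1) then u i - e i - uc0 k₁ k₂ K N f i else 0)).1 (by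
      have h0 := ha.left
      have h1 := ha.right
      refine ⟨fun i hi => ?_, ?_, ?_, fun i hi => if_neg hi⟩
      · have e1 := ha.eq i hi
        have e3 := he.eq i hi
        rw [Finset.mem_Icc] at hi
        have e2 := hu.2 i (by rw [Finset.mem_Icc]; omega)
        have e4 := contOp_eq_atomOp_add k₁ k₂ u i
        rw [e2] at e4
        rw [lap1Sq, if_pos (by rw [Finset.mem_Icc]; omega)] at e3
        generalize lap1 (lap1 u) i = g at e3 e4
        simp only [contOp, lap1] at e1 e3 e4 ⊢
        rw [if_pos (by rw [Finset.mem_Icc]; omega), if_pos (by rw [Finset.mem_Icc]; omega),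
          if_pos (by rw [Finset.mem_Icc]; omega)]
        simp only [uc0, Pi.zero_apply]
        linarith
      · rw [if_pos (by rw [Finset.mem_Icc]; omega), uc0, h0, he.left, sub_zero, sub_zero]
      · rw [if_pos (by rw [Finset.mem_Icc]; omega), uc0, h1, he.right, hu.1.2.2.1, sub_zero,
          sub_zero])
  intro i hi
  rw [vc, ← key]
  simp only [if_pos hi]
  ring

theorem contSub_sum_sq_le {k₁ k₂ : ℝ} (hk : 0 < k₁ + 4 * k₂) {K N : ℕ} (hKN : K + 1 < N)
    (h : ℤ → ℝ) :
    ∑ i ∈ Finset.Icc (K : ℤ) (N - 1), contSub k₁ k₂ K N (fun i => k₂ * h i) 0 i ^ 2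
      ≤ ((N : ℝ) - K) ^ 4 *
        ((k₂ / (k₁ + 4 * k₂)) ^ 2 * ∑ i ∈ Finset.Icc (K : ℤ) (N - 1), h i ^ 2) := by
  have he := isContSub_contSub hk (show (K : ℤ) < N - 1 by omega) (fun i => k₂ * h i) 0
  set e := contSub k₁ k₂ K N (fun i => k₂ * h i) 0
  have hcast : ((K + (N - 1 - K : ℕ) : ℤ)) = N - 1 := by omega
  have key := sum_sq_le_of_dirichlet K (N - 1 - K) e (fun i => -(k₂ / (k₁ + 4 * k₂)) * h i) he.left
    (by rw [hcast]; exact he.right) (fun i hi => by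
      rw [hcast] at hi
      have := he.eq i (by rw [Finset.mem_Icc] at hi ⊢; omega)
      rw [contOp] at this
      have hq : (k₁ + 4 * k₂) * (k₂ / (k₁ + 4 * k₂)) = k₂ := mul_div_cancel₀ _ hk.ne'
      refine mul_left_cancel₀ hk.ne' ?_
      linear_combination -this + h i * hq)
  rw [hcast] at key
  refine key.trans ?_
  simp only [mul_pow, neg_sq]
  rw [← Finset.mul_sum]
  have : ((N - 1 - K : ℕ) : ℝ) ≤ N - K := by
    rw [Nat.sub_sub, Nat.cast_sub (by omega)]
    push_cast
    linarith
  have h0 : 0 ≤ ∑ i ∈ Finset.Icc (K : ℤ) (N - 1), h i ^ 2 := Finset.sum_nonneg fun _ _ => sq_nonneg _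
  gcongr

/-- The coupling error in terms of the error of the continuum model. -/
theorem sum_error_sq_le {k₁ k₂ : ℝ} (hk₂ : k₂ < 0) (hk : 0 < k₁ + 4 * k₂) :
    ∃ C : ℝ, 0 ≤ C ∧ ∀ (K m L N : ℕ), 0 < K → 4 ≤ m → L = K + m → L < N →
      ∀ f u : ℤ → ℝ, IsAtomisticSolution k₁ k₂ N f u →
      ∀ θ : (ℝ × ℝ) × ℝ, IsMinOn (reducedObjective k₁ k₂ K L N f) Set.univ θ →
        ∑ i ∈ Finset.Icc (0 : ℤ) N, (u - atcMap k₁ k₂ K L N f θ) i ^ 2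
          ≤ C * (1 + (L / m : ℝ) ^ 2 * (N / m)) *
            ∑ i ∈ Finset.Icc (K : ℤ) (N - 1),
              contSub k₁ k₂ K N (fun i => k₂ * lap1Sq N u i) 0 i ^ 2 := by
  classical
  obtain ⟨C, hC, hstab⟩ := overlap_stability (div_pos (neg_pos.2 hk₂) hk)
  -- With `W² = 4 E`, `V` contributes `4 C`, `2 Y²` contributes `8 C` and `2 e²` contributes `2`.
  refine ⟨12 * C + 2, by positivity, ?_⟩
  intro K m L N hK hm hL hLN f u hu θ hθ
  have hKN : (K : ℤ) < N - 1 := by omega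
  have hL3 : (3 : ℤ) ≤ L := by omega
  have hua := isAtomSub_atomSub hk₂.le hk hL3 f 0
  have hva := isAtomSub_atomSub hk₂.le hk hL3 0 θ.1
  have htc := uc0_add_vc_trace hk (by omega) hKN hu
  have hta := ua0_add_va_trace hk₂.le hk hL3 (by omega) hu
  set e := contSub k₁ k₂ K N (fun i => k₂ * lap1Sq N u i) 0
  set E := ∑ i ∈ Finset.Icc (K : ℤ) (N - 1), e i ^ 2 with hE
  have hE0 : 0 ≤ E := Finset.sum_nonneg fun _ _ => sq_nonneg _
  set V : ℤ → ℝ := fun i => u i - (ua0 k₁ k₂ L f i + va k₁ k₂ L θ.1 i) with hV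
  set Y : ℤ → ℝ := fun i => vc k₁ k₂ K N (u K) i - vc k₁ k₂ K N θ.2 i with hY
  have heO : ∑ i ∈ Finset.Icc (K : ℤ) L, e i ^ 2 ≤ E :=
    Finset.sum_le_sum_of_subset_of_nonneg (Finset.Icc_subset_Icc le_rfl (by omega))
      fun _ _ _ => sq_nonneg _
  have hVY : ∑ i ∈ Finset.Icc (K : ℤ) L, (V i - Y i) ^ 2 ≤ (2 * √E) ^ 2 := by
    -- The competitor is the exact trace of `u`, whose mismatch on the overlap is exactly `e`.
    have hmin := isMinOn_iff.1 hθ ((u (L - 1), u L), u K) (Set.mem_univ _)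
    rw [reducedObjective_eq, reducedObjective_eq] at hmin
    have h1 : ∑ i ∈ Finset.Icc (K : ℤ) L, ((ua0 k₁ k₂ L f i + va k₁ k₂ L (u (L - 1), u L) i)
        - (uc0 k₁ k₂ K N f i + vc k₁ k₂ K N (u K) i)) ^ 2 = ∑ i ∈ Finset.Icc (K : ℤ) L, e i ^ 2 := by
      refine Finset.sum_congr rfl fun i hi => ?_
      rw [Finset.mem_Icc] at hi
      rw [hta i (by rw [Finset.mem_Icc]; omega), htc i (by rw [Finset.mem_Icc]; omega)]
      ring
    simp only [h1] at hmin
    have h2 : ∀ i ∈ Finset.Icc (K : ℤ) L, (V i - Y i) ^ 2 ≤ 2 * e i ^ 2 + 2 *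
        ((ua0 k₁ k₂ L f i + va k₁ k₂ L θ.1 i) - (uc0 k₁ k₂ K N f i + vc k₁ k₂ K N θ.2 i)) ^ 2 := by
      intro i hi
      rw [Finset.mem_Icc] at hi
      have h3 := htc i (by rw [Finset.mem_Icc]; omega)
      set w := (ua0 k₁ k₂ L f i + va k₁ k₂ L θ.1 i) - (uc0 k₁ k₂ K N f i + vc k₁ k₂ K N θ.2 i)
        with hw
      have h4 : V i - Y i = e i - w := by
        simp only [hV, hY, hw]
        linarith
      rw [h4]
      nlinarith [sq_nonneg (e i + w)]
    refine (Finset.sum_le_sum h2).trans ?_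
    rw [Finset.sum_add_distrib, ← Finset.mul_sum, ← Finset.mul_sum, mul_pow, Real.sq_sqrt hE0]
    linarith
  have hvK := isContSub_contSub hk hKN 0 (u K)
  have hvθ := isContSub_contSub hk hKN 0 θ.2
  obtain ⟨hsV, hsY⟩ := hstab K m L N V Y (2 * √E) hK hm hL hLN
    (by simp only [hV, ua0, va, hua.left0, hva.left0, hu.1.1]; norm_num)
    (by simp only [hV, ua0, va, hua.left1, hva.left1, hu.1.2.1]; norm_num)
    (fun i hi => by
      have e1 := hua.eq i hi
      have e2 := hva.eq i hi
      rw [Finset.mem_Icc] at hi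
      have e3 := hu.2 i (by rw [Finset.mem_Icc]; omega)
      have e4 : atomOp k₁ k₂ V i = 0 := by
        simp only [atomOp, lap1, lap2, hV, ua0, va, Pi.zero_apply] at e1 e2 e3 ⊢
        linarith
      rw [atomOp_eq_lap1 hk.ne', neg_eq_zero] at e4
      exact (mul_eq_zero.1 e4).resolve_left hk.ne')
    (fun i hi => by
      have e1 := hvK.eq i hi
      have e2 := hvθ.eq i hi
      have e4 : contOp k₁ k₂ Y i = 0 := by
        simp only [contOp, lap1, hY, vc, Pi.zero_apply] at e1 e2 ⊢
        linarith
      rw [contOp, neg_eq_zero] at e4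
      exact (mul_eq_zero.1 e4).resolve_left hk.ne')
    (by simp only [hY, vc, hvK.right, hvθ.right, sub_zero])
    (by positivity) hVY
  rw [mul_pow, Real.sq_sqrt hE0] at hsV hsY
  have hsplit : ∀ i ∈ Finset.Icc (0 : ℤ) N, (u - atcMap k₁ k₂ K L N f θ) i ^ 2
      ≤ (if i ∈ Finset.Icc (0 : ℤ) L then V i ^ 2 else 0)
        + if i ∈ Finset.Icc (L + 1 : ℤ) (N - 1) then 2 * Y i ^ 2 + 2 * e i ^ 2 else 0 := by
    intro i hi
    rw [Finset.mem_Icc] at hi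
    rw [Pi.sub_apply, atcMap]
    by_cases h1 : i ∈ Finset.Icc (0 : ℤ) L
    · rw [if_pos h1, if_pos h1, if_neg (by rw [Finset.mem_Icc] at h1 ⊢; omega), add_zero]
    · rw [if_neg h1, if_neg h1, zero_add]
      by_cases h2 : i ∈ Finset.Icc (L + 1 : ℤ) (N - 1)
      · rw [if_pos h2, if_pos h2]
        rw [Finset.mem_Icc] at h2
        have h3 := htc i (by rw [Finset.mem_Icc]; omega)
        have h4 : u i - (uc0 k₁ k₂ K N f i + vc k₁ k₂ K N θ.2 i) = Y i + e i := by
          simp only [hY]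
          linarith
        rw [h4]
        nlinarith [sq_nonneg (Y i - e i)]
      · rw [if_neg h2, if_neg h2]
        rw [Finset.mem_Icc] at h1 h2
        obtain rfl : i = N := by omega
        rw [hu.1.2.2.2]
        norm_num
  refine (Finset.sum_le_sum hsplit).trans ?_
  rw [Finset.sum_add_distrib, Finset.sum_ite_mem, Finset.sum_ite_mem]
  have s1 : ∑ i ∈ Finset.Icc (0 : ℤ) N ∩ Finset.Icc (0 : ℤ) L, V i ^ 2
      ≤ ∑ i ∈ Finset.Icc (0 : ℤ) L, V i ^ 2 :=
    Finset.sum_le_sum_of_subset_of_nonneg Finset.inter_subset_right fun _ _ _ => sq_nonneg _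
  have s2 : ∑ i ∈ Finset.Icc (0 : ℤ) N ∩ Finset.Icc (L + 1 : ℤ) (N - 1), (2 * Y i ^ 2 + 2 * e i ^ 2)
      ≤ ∑ i ∈ Finset.Icc (L + 1 : ℤ) (N - 1), (2 * Y i ^ 2 + 2 * e i ^ 2) :=
    Finset.sum_le_sum_of_subset_of_nonneg Finset.inter_subset_right fun _ _ _ => by positivity
  have s4 : ∑ i ∈ Finset.Icc (L + 1 : ℤ) (N - 1), (2 * Y i ^ 2 + 2 * e i ^ 2)
      = 2 * ∑ i ∈ Finset.Icc (L + 1 : ℤ) (N - 1), Y i ^ 2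
        + 2 * ∑ i ∈ Finset.Icc (L + 1 : ℤ) (N - 1), e i ^ 2 := by
    rw [Finset.sum_add_distrib, Finset.mul_sum, Finset.mul_sum]
  have s3 : ∑ i ∈ Finset.Icc (L + 1 : ℤ) (N - 1), e i ^ 2 ≤ E :=
    Finset.sum_le_sum_of_subset_of_nonneg (Finset.Icc_subset_Icc (by omega) le_rfl)
      fun _ _ _ => sq_nonneg _
  have hg : 0 ≤ (L / m : ℝ) ^ 2 * (N / m) * E := by positivity
  linarith

end AtC

end

/-! ### The error estimate. -/

theorem theorem4p4 (k₁ k₂ : ℝ) (hk₁ : 0 < k₁) (hk₂ : k₂ < 0) (hk : 0 < k₁ + 4 * k₂)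
    (p : ℝ) (hp : 1 < p) (M : ℝ) (hM : 0 < M) :
    ∃ c : ℝ, 0 < c ∧
      ∀ (K L N : ℤ) (γ : ℝ), 0 < K → K < L → L < N →
        (L : ℝ) ≤ M * (N : ℝ) ^ (1 / p) →
        ((L : ℝ) - K) / L = γ → 3 / (L : ℝ) < γ → γ < 1 →
        ∀ f u : ℤ → ℝ, AtC.MemU0 N f → AtC.IsAtomisticSolution k₁ k₂ N f u →
        ∀ θ : (ℝ × ℝ) × ℝ, IsMinOn (AtC.reducedObjective k₁ k₂ K L N f) Set.univ θ →
          AtC.l2norm (Finset.Icc 0 N) (u - AtC.atcMap k₁ k₂ K L N f θ)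
            ≤ c * ((1 + γ⁻¹ * Real.sqrt ((N : ℝ) / ((L : ℝ) - K))) * ((N : ℝ) - K) ^ 2
                * AtC.l2norm (Finset.Icc K (N - 1)) (AtC.lap1Sq N u)) := by
  obtain ⟨C, hC, hmain⟩ := AtC.sum_error_sq_le hk₂ hk
  set a := k₂ / (k₁ + 4 * k₂) with ha
  refine ⟨√(C * a ^ 2) + 1, by positivity, ?_⟩
  intro K L N γ hK hKL hLN _ hγ h3 _ f u _ hu θ hθ
  lift K to ℕ using hK.le
  lift L to ℕ using (hK.trans hKL).le
  lift N to ℕ using (hK.trans (hKL.trans hLN)).le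
  simp only [Int.cast_natCast] at *
  obtain ⟨m, rfl⟩ : ∃ m, L = K + m := ⟨L - K, by omega⟩
  have hL0 : (0 : ℝ) < (K + m : ℕ) := by exact_mod_cast (by omega : 0 < K + m)
  have hmR : ((K + m : ℕ) : ℝ) - K = m := by push_cast; ring
  rw [hmR] at hγ ⊢
  -- Since `γ = m / L`, the condition `3 / L < γ` says `m > 3`.
  have hm : 4 ≤ m := by
    rw [← hγ, div_lt_div_iff_of_pos_right hL0] at h3
    exact_mod_cast h3
  have hm0 : (0 : ℝ) < m := by exact_mod_cast (by omega : 0 < m)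
  have h1 := hmain K m (K + m) N (by omega) hm rfl (by omega) f u hu θ hθ
  have h2 := AtC.contSub_sum_sq_le (k₂ := k₂) hk (show K + 1 < N by omega) (AtC.lap1Sq N u)
  rw [← AtC.l2norm_sq] at h1
  rw [← AtC.l2norm_sq _ (AtC.lap1Sq N u)] at h2
  have hγi : γ⁻¹ = ((K + m : ℕ) : ℝ) / m := by rw [← hγ, inv_div]
  have hγ0 : 0 ≤ γ⁻¹ := by rw [hγi]; positivity
  rw [← hγi] at h1
  have hν : 0 ≤ (N : ℝ) / m := by positivity
  have hG := AtC.l2norm_nonneg (Finset.Icc (K : ℤ) (N - 1)) (AtC.lap1Sq N u)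
  set G := AtC.l2norm (Finset.Icc (K : ℤ) (N - 1)) (AtC.lap1Sq N u)
  set S := √((N : ℝ) / m) with hS
  have hS0 : 0 ≤ S := Real.sqrt_nonneg _
  have hS2 : S ^ 2 = (N : ℝ) / m := Real.sq_sqrt hν
  rw [← hS2] at h1
  have hc2 : √(C * a ^ 2) ^ 2 = C * a ^ 2 := Real.sq_sqrt (by positivity)
  have hc0 : 0 ≤ √(C * a ^ 2) := Real.sqrt_nonneg _
  set c := √(C * a ^ 2)
  refine le_trans (b := c * ((1 + γ⁻¹ * S) * ((N : ℝ) - K) ^ 2 * G)) ?_ ?_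
  · refine (abs_le_of_sq_le_sq' ?_ (by positivity)).2
    -- The squared estimate has `1 + x²` with `x = γ⁻¹ S ≥ 0`; bounding it by `(1 + x)²` allows the
    -- root to be taken.
    have h4 : 1 + γ⁻¹ ^ 2 * S ^ 2 ≤ (1 + γ⁻¹ * S) ^ 2 := by
      have : 0 ≤ γ⁻¹ * S := by positivity
      nlinarith
    calc _ ≤ C * (1 + γ⁻¹ ^ 2 * S ^ 2) * (((N : ℝ) - K) ^ 4 * (a ^ 2 * G ^ 2)) :=
          h1.trans (mul_le_mul_of_nonneg_left h2 (by positivity))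
      _ ≤ C * (1 + γ⁻¹ * S) ^ 2 * (((N : ℝ) - K) ^ 4 * (a ^ 2 * G ^ 2)) := by
          have : 0 ≤ ((N : ℝ) - K) ^ 4 := by positivity
          gcongr
      _ = (C * a ^ 2) * ((1 + γ⁻¹ * S) * ((N : ℝ) - K) ^ 2 * G) ^ 2 := by ring
      _ = _ := by rw [← hc2, ← mul_pow]
  · gcongr
    linarith
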